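/- For a $d$-polytope $P$ (a convex polytope of dimension $d$ in some $\mathbb{R}^n$) and $S=\{i_1<\dots<i_k\}\subseteq\{0,\dots,d-1\}$ let $f_S(P)$ be the number of chains $F_1\subset\dots\subset F_k$ of faces of $P$ with $\dim F_j=i_j$; write $f_i=f_{\{i\}}$, $f_{ij}=f_{\{i,j\}}$. For $\alpha=(\alpha_S)_S\in\mathbb{R}^{2^{\{0,\dots,d-1\}}}$ put $\alpha(P)=\sum_S\alpha_S f_S(P)$, and let $\mathcal{F}_d$ be the set of all such $\alpha$ with $\alpha(P)\ge 0$ for every $d$-polytope $P$. A polytope is centrally symmetric (cs) if $P=-P$. Hanner polytopes are defined recursively: every cs $1$-polytope is a Hanner polytope, and so are the direct product $A+B$ and the direct sum $\operatorname{conv}(A\cup B)$ of two Hanner polytopes $A,B$ whose linear spans intersect only in $0$. Conjecture C (Kalai) in dimension $d$ says: for every cs $d$-polytope $P$ there is a $d$-dimensional Hanner polytope $H$ such that $\alpha(P)\ge\alpha(H)$ for all $\alpha\in\mathcal{F}_d$. **Theorem.** Conjecture C is false in dimension $4$. More precisely, the flag functional $$\alpha(P)=f_{02}(P)-\tfrac32\bigl(f_1(P)+f_2(P)\bigr)$$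 is non-negative on all $4$-polytopes, i.e. $\alpha\in\mathcal{F}_4$, and on every $4$-polytope it equals $\tfrac12(\ell_1+\ell_2)$, where $\ell_1=f_{02}-3f_2$ and $\ell_2=f_{13}-3f_1$. The set $P_4=[-1,1]^4\cap\{x\in\mathbb{R}^4:-2\le x_1+x_2+x_3+x_4\le 2\}$ is a cs $4$-polytope with $\alpha(P_4)=6$, whereas every $4$-dimensional Hanner polytope $H$ has $\alpha(H)=9$ or $\alpha(H)=12$. -/

import Mathlib

open scoped Pointwise

noncomputable section

/-- The dimension of a (nonempty) set in a real vector space: that of its affine hull. -/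
def polyDim {E : Type*} [AddCommGroup E] [Module ℝ E] (P : Set E) : ℕ :=
  Module.finrank ℝ (vectorSpan ℝ P)

/-- `P` is a (convex) `d`-polytope: the convex hull of a nonempty finite set of points, and its
affine hull has dimension `d`. -/
def IsPolytopeOfDim {E : Type*} [AddCommGroup E] [Module ℝ E] (d : ℕ) (P : Set E) : Prop :=
  P.Nonempty ∧ (∃ s : Set E, s.Finite ∧ P = convexHull ℝ s) ∧ polyDim P = d

/-- `P` is centrally symmetric: `P = -P`. -/
def IsCentrallySymmetric {E : Type*} [AddCommGroup E] (P : Set E) : Prop :=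
  P = -P

/-- `F` is a `k`-dimensional (nonempty) face of `P`: the set of maximizers over `P` of some linear
functional, with affine hull of dimension `k`. -/
def IsFaceOfDim {E : Type*} [AddCommGroup E] [Module ℝ E] [TopologicalSpace E]
    (P : Set E) (k : ℕ) (F : Set E) : Prop :=
  F.Nonempty ∧ IsExposed ℝ P F ∧ polyDim F = k

/-- The flag number `f_S(P)` for `S ⊆ {0, …, d-1}`: the number of chains of faces
`F_{i₁} ⊂ ⋯ ⊂ F_{iₖ}` of `P` with `dim F_i = i` for each `i ∈ S = {i₁ < ⋯ < iₖ}`. -/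
def flagNumber {E : Type*} [AddCommGroup E] [Module ℝ E] [TopologicalSpace E]
    {d : ℕ} (S : Finset (Fin d)) (P : Set E) : ℕ :=
  Set.ncard {F : {i // i ∈ S} → Set E | StrictMono F ∧ ∀ i, IsFaceOfDim P (i.1 : ℕ) (F i)}

/-- The value `α(P) = ∑_S α_S f_S(P)` of a linear functional on flag vectors. -/
def flagEval {E : Type*} [AddCommGroup E] [Module ℝ E] [TopologicalSpace E]
    {d : ℕ} (α : Finset (Fin d) → ℝ) (P : Set E) : ℝ :=
  ∑ S : Finset (Fin d), α S * (flagNumber S P : ℝ)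

/-- The cone of all linear functionals on `ℝ^(2^{0,…,d-1})` that are non-negative on the flag
vectors of all (not necessarily centrally symmetric) `d`-polytopes. -/
def flagCone (d : ℕ) : Set (Finset (Fin d) → ℝ) :=
  {α | ∀ (n : ℕ) (P : Set (Fin n → ℝ)), IsPolytopeOfDim d P → 0 ≤ flagEval α P}

/-- Hanner polytopes: every centrally symmetric `1`-polytope is one, and so are the direct product
`A + B` and the direct sum `conv (A ∪ B)` of two Hanner polytopes `A`, `B` that lie in
complementary linear subspaces (internal direct products and sums, so the class is closed under
injective linear maps). -/
inductive IsHanner {E : Type*} [AddCommGroup E] [Module ℝ E] : Set E → Prop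
  | segment (A : Set E) (hA : IsPolytopeOfDim 1 A) (hs : IsCentrallySymmetric A) : IsHanner A
  | directProduct (A B : Set E) (hA : IsHanner A) (hB : IsHanner B)
      (hAB : Disjoint (Submodule.span ℝ A) (Submodule.span ℝ B)) : IsHanner (A + B)
  | directSum (A B : Set E) (hA : IsHanner A) (hB : IsHanner B)
      (hAB : Disjoint (Submodule.span ℝ A) (Submodule.span ℝ B)) :
      IsHanner (convexHull ℝ (A ∪ B))

/-- Kalai's Conjecture C in dimension `d`: for every centrally symmetric `d`-polytope `P` there is
a `d`-dimensional Hanner polytope `H` with `α(P) ≥ α(H)` for all `α` in the flag cone. -/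
def KalaiConjectureC (d : ℕ) : Prop :=
  ∀ (n : ℕ) (P : Set (Fin n → ℝ)), IsPolytopeOfDim d P → IsCentrallySymmetric P →
    ∃ (m : ℕ) (H : Set (Fin m → ℝ)), IsHanner H ∧ polyDim H = d ∧
      ∀ α ∈ flagCone d, flagEval α H ≤ flagEval α P

/-- The functional `f_02 - (3/2) (f_1 + f_2)` on flag vectors of `4`-polytopes. -/
def alphaFunctional : Finset (Fin 4) → ℝ :=
  Pi.single {0, 2} 1 - (3 / 2 : ℝ) • (Pi.single {1} 1 + Pi.single {2} 1)

/-- `ℓ₁(P) = f_02(P) - 3 f_2(P)`. -/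
def ellOne {E : Type*} [AddCommGroup E] [Module ℝ E] [TopologicalSpace E] (P : Set E) : ℝ :=
  (flagNumber ({0, 2} : Finset (Fin 4)) P : ℝ) - 3 * (flagNumber ({2} : Finset (Fin 4)) P : ℝ)

/-- `ℓ₂(P) = f_13(P) - 3 f_1(P)`. -/
def ellTwo {E : Type*} [AddCommGroup E] [Module ℝ E] [TopologicalSpace E] (P : Set E) : ℝ :=
  (flagNumber ({1, 3} : Finset (Fin 4)) P : ℝ) - 3 * (flagNumber ({1} : Finset (Fin 4)) P : ℝ)

/-- `P_4 = [-1,1]^4 ∩ {-2 ≤ x_1 + x_2 + x_3 + x_4 ≤ 2}`. -/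
def polytopeP4 : Set (Fin 4 → ℝ) :=
  {x | (∀ i, x i ∈ Set.Icc (-1 : ℝ) 1) ∧ ∑ i, x i ∈ Set.Icc (-2 : ℝ) 2}

end

/-! Every 2-face of a polytope is a polygon, with as many vertices as edges and at least three of
each. Dually, the faces around an edge of a 4-polytope form a polygon: the edge lies in as many
2-faces as facets, and in at least three. Counting incidences by 2-faces gives `f_02 = f_12` and `ℓ₁
≥ 0`; counting by edges gives `f_12 = f_13` and `ℓ₂ ≥ 0`. Hence `f_02 = f_13`, so the functional is
`(ℓ₁ + ℓ₂) / 2`, which is non-negative. It measures how far a polytope is from having only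
triangular 2-faces and only edges in exactly three facets. Both polygon statements rest on the
diamond property (`IsFace.ncard_between`), which is proved by rotating a supporting hyperplane about
a face.

`P_4` is the 4-cube with two opposite vertices cut off by hyperplanes through their neighbours. All
its edges lie in three facets and its only non-triangular 2-faces are twelve squares, whence the
value 6. Hanner polytopes of dimension 4 arise from segments by few products and sums, and all have
value at least 9. As the functional lies in the flag cone, no Hanner polytope can serve for `P_4`.

The numerical values are obtained from incidences. A `Realization` describes a polytope by points
and by inequalities; the table of tight inequalities determines its faces (`Realization.face_eq`),
and a grading of the resulting masks determines their dimensions (`Realization.polyDim_maskHull`).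
Products and sums act on the tables (`Realizes.prod`, `Realizes.sum`), so flag numbers reduce to
finite computations with bit masks. -/

/-! ### Faces of polytopes -/

/-- A polytope: the convex hull of a finite set. -/
def IsPolytope {E : Type*} [AddCommGroup E] [Module ℝ E] (P : Set E) : Prop :=
  ∃ V : Finset E, P = convexHull ℝ (V : Set E)

/-- A nonempty exposed face. -/
def IsFace {E : Type*} [AddCommGroup E] [Module ℝ E] [TopologicalSpace E] (P F : Set E) : Prop :=
  F.Nonempty ∧ IsExposed ℝ P F

section Faces

variable {E : Type*} [NormedAddCommGroup E] [NormedSpace ℝ E]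

theorem isFaceOfDim_iff {P F : Set E} {k : ℕ} :
    IsFaceOfDim P k F ↔ IsFace P F ∧ polyDim F = k := by
  simp only [IsFaceOfDim, IsFace, and_assoc]

theorem IsFace.subset {P F : Set E} (h : IsFace P F) : F ⊆ P := h.2.subset

theorem IsFace.exists_functional {P F : Set E} (h : IsFace P F) :
    ∃ (l : E →ₗ[ℝ] ℝ) (c : ℝ), (∀ x ∈ P, l x ≤ c) ∧ F = {x ∈ P | l x = c} := by
  obtain ⟨⟨z, hz⟩, hexp⟩ := h
  obtain ⟨l, rfl⟩ := hexp ⟨z, hz⟩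
  refine ⟨l, l z, hz.2, Set.ext fun x => ⟨fun hx => ⟨hx.1, le_antisymm (hz.2 x hx.1) (hx.2 z hz.1)⟩,
    fun hx => ⟨hx.1, fun y hy => ?_⟩⟩⟩
  have h1 := hz.2 y hy
  have h2 : l x = l z := hx.2
  linarith

theorem isFace_of_functional [FiniteDimensional ℝ E] {P : Set E} (l : E →ₗ[ℝ] ℝ) (c : ℝ)
    (hl : ∀ x ∈ P, l x ≤ c) (hne : {x ∈ P | l x = c}.Nonempty) : IsFace P {x ∈ P | l x = c} := by
  refine ⟨hne, fun _ => ⟨LinearMap.toContinuousLinearMap l, ?_⟩⟩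
  obtain ⟨z, hz, hzc⟩ := hne
  ext x
  simp only [Set.mem_ofPred_eq, LinearMap.coe_toContinuousLinearMap']
  refine and_congr_right fun hx => ⟨fun h y hy => h ▸ hl y hy, fun h => ?_⟩
  exact le_antisymm (hl x hx) (hzc ▸ h z hz)

theorem isFace_self {P : Set E} (h : P.Nonempty) : IsFace P P := ⟨h, IsExposed.refl P⟩

theorem IsFace.inter {P F G : Set E} (hF : IsFace P F) (hG : IsFace P G) (h : (F ∩ G).Nonempty) :
    IsFace P (F ∩ G) := ⟨h, hF.2.inter hG.2⟩

theorem IsFace.mono {P F G : Set E} (hF : IsFace P F) (hG : G ⊆ P) (hFG : F ⊆ G) : IsFace G F :=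
  ⟨hF.1, hF.2.mono hG hFG⟩

/-- The maximal face of a convex hull in some direction is the convex hull of the generating
points on it. -/
theorem maximizers_convexHull (V : Finset E) (l : E →ₗ[ℝ] ℝ) (c : ℝ)
    (hl : ∀ x ∈ V, l x ≤ c) :
    {x ∈ convexHull ℝ (V : Set E) | l x = c} = convexHull ℝ {x | x ∈ V ∧ l x = c} := by
  classical
  have hset : {x | x ∈ V ∧ l x = c} = ((V.filter fun x => l x = c : Finset E) : Set E) := by
    ext; simp
  apply Set.Subset.antisymm
  · rintro x ⟨hx, hxc⟩
    rw [Finset.mem_convexHull'] at hx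
    obtain ⟨w, hw0, hw1, rfl⟩ := hx
    -- The terms are non-negative and sum to zero, so the weights are supported on the points with
    -- `l y = c`.
    have hsum : ∑ y ∈ V, w y * (c - l y) = 0 := by
      have : ∑ y ∈ V, w y * (c - l y) = c * ∑ y ∈ V, w y - l (∑ y ∈ V, w y • y) := by
        simp only [map_sum, map_smul, smul_eq_mul, Finset.mul_sum, ← Finset.sum_sub_distrib]
        exact Finset.sum_congr rfl fun y _ => by ring
      rw [this, hw1, hxc]; ring
    have hz := (Finset.sum_eq_zero_iff_of_nonneg fun y hy =>
      mul_nonneg (hw0 y hy) (sub_nonneg.2 (hl y hy))).1 hsum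
    have hw' : ∀ y ∈ V, l y ≠ c → w y = 0 := fun y hy hne =>
      (mul_eq_zero.1 (hz y hy)).resolve_right fun h => hne (by linarith)
    rw [hset, Finset.mem_convexHull']
    refine ⟨w, fun y hy => hw0 y (Finset.mem_filter.1 hy).1, ?_, ?_⟩
    · rw [← hw1]
      refine Finset.sum_subset (Finset.filter_subset _ _) fun y hy hn => hw' y hy fun h => hn ?_
      exact Finset.mem_filter.2 ⟨hy, h⟩
    · refine Finset.sum_subset (Finset.filter_subset _ _) fun y hy hn => ?_
      rw [hw' y hy fun h => hn (Finset.mem_filter.2 ⟨hy, h⟩), zero_smul]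
  · refine convexHull_min (fun x hx => ⟨subset_convexHull ℝ _ hx.1, hx.2⟩) ?_
    exact (convex_convexHull ℝ _).inter (convex_hyperplane l.isLinear c)

theorem le_of_mem_convexHull {V : Set E} {l : E →ₗ[ℝ] ℝ} {c : ℝ} (hl : ∀ x ∈ V, l x ≤ c) :
    ∀ x ∈ convexHull ℝ V, l x ≤ c := fun _ hx =>
  convexHull_min (t := {x | l x ≤ c}) hl (convex_halfSpace_le l.isLinear c) hx

theorem IsFace.eq_convexHull {V : Finset E} {F : Set E} (h : IsFace (convexHull ℝ (V : Set E)) F) :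
    F = convexHull ℝ {x | x ∈ V ∧ x ∈ F} := by
  obtain ⟨l, c, hl, hF⟩ := h.exists_functional
  have hlV : ∀ x ∈ V, l x ≤ c := fun x hx => hl x (subset_convexHull ℝ _ hx)
  have : {x | x ∈ V ∧ x ∈ F} = {x | x ∈ V ∧ l x = c} := by
    ext x
    simp only [hF, Set.mem_ofPred_eq]
    exact ⟨fun h => ⟨h.1, h.2.2⟩, fun h => ⟨h.1, subset_convexHull ℝ _ h.1, h.2⟩⟩
  rw [this, ← maximizers_convexHull V l c hlV, ← hF]

theorem IsFace.isPolytope {P F : Set E} (hP : IsPolytope P) (h : IsFace P F) : IsPolytope F := by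
  classical
  obtain ⟨V, rfl⟩ := hP
  refine ⟨V.filter (· ∈ F), ?_⟩
  convert h.eq_convexHull using 2
  ext; simp

/-- A face is determined by the generating points it contains. -/
theorem finite_faces {P : Set E} (hP : IsPolytope P) : {F | IsFace P F}.Finite := by
  obtain ⟨V, rfl⟩ := hP
  refine (V.finite_toSet.finite_subsets.image (convexHull ℝ)).subset fun F hF => ?_
  exact ⟨_, fun x hx => hx.1, (IsFace.eq_convexHull hF).symm⟩

/-- A face of a face of a polytope is a face. -/
theorem IsFace.trans [FiniteDimensional ℝ E] {P F G : Set E} (hP : IsPolytope P) (hF : IsFace P F)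
    (hG : IsFace F G) : IsFace P G := by
  obtain ⟨V, rfl⟩ := hP
  obtain ⟨l, c, hl, hFl⟩ := hF.exists_functional
  obtain ⟨m, d, hm, hGm⟩ := hG.exists_functional
  have hlV : ∀ x ∈ V, l x ≤ c := fun x hx => hl x (subset_convexHull ℝ _ hx)
  -- With `N` this large, `N • l + m` is maximal exactly on `G`: at a generator off `F` the loss `N
  -- * (c - l v)` strictly exceeds the possible gain `m v - d`.
  obtain ⟨N, hN⟩ : ∃ N : ℝ, ∀ v ∈ V, l v < c → (m v - d) / (c - l v) < N := by
    obtain ⟨M, hM⟩ := (V.image fun v => (m v - d) / (c - l v)).exists_le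
    exact ⟨M + 1, fun v hv _ => (hM _ (Finset.mem_image_of_mem _ hv)).trans_lt (lt_add_one M)⟩
  have key : ∀ v ∈ V, (N • l + m) v ≤ N * c + d ∧ ((N • l + m) v = N * c + d → v ∈ G) := by
    intro v hv
    have hvP := subset_convexHull ℝ (V : Set E) hv
    simp only [LinearMap.add_apply, LinearMap.smul_apply, smul_eq_mul]
    rcases (hlV v hv).lt_or_eq with h | h
    · have h1 := hN v hv h
      rw [div_lt_iff₀ (by linarith)] at h1
      exact ⟨by linarith, fun _ => by linarith⟩
    · have hvF : v ∈ F := hFl ▸ ⟨hvP, h⟩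
      have := hm v hvF
      rw [h]
      exact ⟨by linarith, fun h' => hGm ▸ ⟨hvF, by linarith⟩⟩
  have hmax := maximizers_convexHull V (N • l + m) (N * c + d) fun v hv => (key v hv).1
  have hGF : G ⊆ {x ∈ convexHull ℝ (V : Set E) | (N • l + m) x = N * c + d} := by
    intro x hx
    have hxF := hG.subset hx
    have h1 : m x = d := (hGm ▸ hx : x ∈ {x ∈ F | m x = d}).2
    have h2 : l x = c := (hFl ▸ hxF : x ∈ {x ∈ convexHull ℝ (V : Set E) | l x = c}).2
    exact ⟨hF.subset hxF, by simp [h1, h2]⟩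
  have hconvG : Convex ℝ G := by
    rw [hGm, hFl]
    exact ((convex_convexHull ℝ _).inter (convex_hyperplane l.isLinear c)).inter
      (convex_hyperplane m.isLinear d)
  have heq : G = {x ∈ convexHull ℝ (V : Set E) | (N • l + m) x = N * c + d} := by
    refine hGF.antisymm ?_
    rw [hmax]
    exact convexHull_min (fun x hx => (key x hx.1).2 hx.2) hconvG
  rw [heq]
  exact isFace_of_functional _ _ (le_of_mem_convexHull fun v hv => (key v hv).1) (heq ▸ hG.1)

theorem polyDim_mono [FiniteDimensional ℝ E] {F G : Set E} (h : F ⊆ G) : polyDim F ≤ polyDim G :=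
  Submodule.finrank_mono (vectorSpan_mono ℝ h)

/-- A linear functional that is constant on a set vanishes on its direction. -/
theorem vectorSpan_le_ker {F : Set E} {l : E →ₗ[ℝ] ℝ} {c : ℝ} (h : ∀ x ∈ F, l x = c) :
    vectorSpan ℝ F ≤ LinearMap.ker l := by
  rw [vectorSpan_def, Submodule.span_le]
  rintro _ ⟨x, hx, y, hy, rfl⟩
  simp [h x hx, h y hy]

/-- Equal dimension forces equal direction spaces, so the functional supporting `F` is constant on
`G` too, and `G` lies in its maximizer set `F`. -/
theorem IsFace.eq_of_polyDim_le [FiniteDimensional ℝ E] {P F G : Set E} (hF : IsFace P F)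
    (hFG : F ⊆ G) (hG : G ⊆ P) (hd : polyDim G ≤ polyDim F) : F = G := by
  obtain ⟨l, c, -, hFl⟩ := hF.exists_functional
  have hc : ∀ x ∈ F, l x = c := fun x hx => (hFl ▸ hx : x ∈ {x ∈ P | l x = c}).2
  have hspan : vectorSpan ℝ F = vectorSpan ℝ G :=
    Submodule.eq_of_le_of_finrank_le (vectorSpan_mono ℝ hFG) hd
  refine hFG.antisymm fun y hy => ?_
  obtain ⟨x, hx⟩ := hF.1
  have h1 : y - x ∈ vectorSpan ℝ F := hspan ▸ vsub_mem_vectorSpan ℝ hy (hFG hx)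
  have h2 : l (y - x) = 0 := vectorSpan_le_ker hc h1
  rw [hFl]
  refine ⟨hG hy, ?_⟩
  have := hc x hx
  rw [map_sub] at h2
  linarith

theorem IsFace.polyDim_lt [FiniteDimensional ℝ E] {P F G : Set E} (hF : IsFace P F)
    (hFG : F ⊂ G) (hG : G ⊆ P) : polyDim F < polyDim G := by
  by_contra h
  exact hFG.ne (hF.eq_of_polyDim_le hFG.subset hG (not_lt.1 h))

end Faces

/-! ### The diamond property -/

section Diamond

set_option linter.unusedSectionVars false

variable {E : Type*} [NormedAddCommGroup E] [NormedSpace ℝ E] [FiniteDimensional ℝ E]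

/-- Rotating a supporting hyperplane `l = c` of a polytope about its contact face, in a direction
`m`, until it meets further points of the polytope. -/
theorem exists_rotation {P : Set E} (hP : IsPolytope P) {l m : E →ₗ[ℝ] ℝ} {c d : ℝ}
    (hl : ∀ x ∈ P, l x ≤ c) (hm : ∀ x ∈ P, l x = c → m x = d)
    (hlm : ¬ ∃ t : ℝ, ∀ x ∈ P, m x - d = t * (c - l x)) :
    ∃ t : ℝ, (∀ x ∈ P, m x - d ≤ t * (c - l x)) ∧
      IsFace P {x ∈ P | m x - d = t * (c - l x)} ∧
      {x ∈ P | l x = c} ⊂ {x ∈ P | m x - d = t * (c - l x)} ∧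
      {x ∈ P | m x - d = t * (c - l x)} ⊂ P := by
  classical
  obtain ⟨V, rfl⟩ := hP
  set P := convexHull ℝ (V : Set E) with hPdef
  have hVP : ∀ v ∈ V, v ∈ P := fun v hv => subset_convexHull ℝ _ hv
  have hne : (V.filter fun v => l v < c).Nonempty := by
    by_contra h
    rw [Finset.not_nonempty_iff_eq_empty, Finset.filter_eq_empty_iff] at h
    have h' : ∀ v ∈ V, l v = c := fun v hv => le_antisymm (hl v (hVP v hv)) (not_lt.1 (h hv))
    have h2 : ∀ x ∈ P, l x = c := fun x hx =>
      convexHull_min (t := {x | l x = c}) h' (convex_hyperplane l.isLinear c) hx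
    exact hlm ⟨0, fun x hx => by rw [hm x hx (h2 x hx)]; ring⟩
  -- The maximal slope is the least `t` for which `m - d ≤ t * (c - l)` is valid on `P`; the
  -- maximizer `y` is a new contact point.
  obtain ⟨y, hy, hmax⟩ := Finset.exists_max_image _ (fun v => (m v - d) / (c - l v)) hne
  rw [Finset.mem_filter] at hy
  set t := (m y - d) / (c - l y) with ht
  have hcy : c - l y ≠ 0 := by linarith [hy.2]
  have hV : ∀ v ∈ V, (m + t • l) v ≤ d + t * c := by
    intro v hv
    simp only [LinearMap.add_apply, LinearMap.smul_apply, smul_eq_mul]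
    rcases (hl v (hVP v hv)).lt_or_eq with h | h
    · have := hmax v (Finset.mem_filter.2 ⟨hv, h⟩)
      rw [div_le_iff₀ (by linarith)] at this
      change m v - d ≤ t * (c - l v) at this
      linarith
    · rw [hm v (hVP v hv) h, h]
  have hle := le_of_mem_convexHull hV
  have hset : {x ∈ P | m x - d = t * (c - l x)} = {x ∈ P | (m + t • l) x = d + t * c} := by
    ext x
    simp only [Set.mem_ofPred_eq, LinearMap.add_apply, LinearMap.smul_apply, smul_eq_mul]
    exact and_congr_right fun _ => ⟨fun h => by linarith, fun h => by linarith⟩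
  have hyG : y ∈ {x ∈ P | m x - d = t * (c - l x)} :=
    ⟨hVP y hy.1, by rw [ht, div_mul_cancel₀ _ hcy]⟩
  refine ⟨t, fun x hx => ?_, ?_, ?_, ?_⟩
  · have := hle x hx
    simp only [LinearMap.add_apply, LinearMap.smul_apply, smul_eq_mul] at this
    linarith
  · rw [hset]
    exact isFace_of_functional _ _ hle (hset ▸ ⟨y, hyG⟩)
  · have hsub : {x ∈ P | l x = c} ⊆ {x ∈ P | m x - d = t * (c - l x)} := by
      rintro x ⟨hx, hxc⟩
      refine ⟨hx, ?_⟩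
      rw [hm x hx hxc, hxc]; ring
    exact (Set.ssubset_iff_of_subset hsub).2 ⟨y, hyG, fun h => absurd h.2 hy.2.ne⟩
  · refine (Set.sep_subset _ _).ssubset_of_ne fun h => hlm ⟨t, fun x hx => ?_⟩
    rw [← h] at hx
    exact hx.2

/-- Both numbers are the least slope for which `g` is bounded by a multiple of `f`: equality at a
point with `f > 0` rules out anything smaller. -/
theorem eq_of_pencil_ratio {P : Set E} {f g : E → ℝ} {s t : ℝ}
    (hs : ∀ x ∈ P, g x ≤ s * f x) (ht : ∀ x ∈ P, g x ≤ t * f x)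
    (hes : ∃ x ∈ P, 0 < f x ∧ g x = s * f x) (het : ∃ x ∈ P, 0 < f x ∧ g x = t * f x) : s = t := by
  obtain ⟨x, hx, hfx, hgx⟩ := hes
  obtain ⟨y, hy, hfy, hgy⟩ := het
  refine le_antisymm ?_ ?_
  · have := ht x hx
    rw [hgx] at this
    exact le_of_mul_le_mul_right this hfx
  · have := hs y hy
    rw [hgy] at this
    exact le_of_mul_le_mul_right this hfy

/-- If the supporting functionals of a face lie in a pencil, exactly two faces lie strictly between
the face and the polytope. -/
theorem ncard_faces_of_pencil {P : Set E} (hP : IsPolytope P) {l m : E →ₗ[ℝ] ℝ} {c d : ℝ}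
    (hl : ∀ x ∈ P, l x ≤ c) (hm : ∀ x ∈ P, l x = c → m x = d)
    (hlm : ¬ ∃ t : ℝ, ∀ x ∈ P, m x - d = t * (c - l x))
    (hspan : ∀ (k : E →ₗ[ℝ] ℝ) (e : ℝ), (∀ x ∈ P, l x = c → k x = e) → (∃ x ∈ P, k x = e) →
      ∃ a b : ℝ, ∀ x ∈ P, e - k x = a * (c - l x) + b * (m x - d)) :
    {G | IsFace P G ∧ {x ∈ P | l x = c} ⊂ G ∧ G ⊂ P}.ncard = 2 := by
  obtain ⟨t, ht, hGt, hFt, htP⟩ := exists_rotation hP hl hm hlm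
  -- The second face comes from rotating in the opposite direction.
  obtain ⟨s, hs, hGs, hFs, hsP⟩ := exists_rotation (m := -m) (d := -d) hP hl
    (fun x hx h => by simp [hm x hx h]) (fun ⟨u, hu⟩ => hlm ⟨-u, fun x hx => by
      have := hu x hx
      simp only [LinearMap.neg_apply] at this
      linarith⟩)
  simp only [LinearMap.neg_apply] at hs hGs hFs hsP
  have extra : ∀ {G : Set E}, G ⊆ P → {x ∈ P | l x = c} ⊂ G → ∃ x ∈ G, 0 < c - l x := by
    intro G hG h
    obtain ⟨x, hx, hxF⟩ := Set.exists_of_ssubset h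
    refine ⟨x, hx, ?_⟩
    have h1 := hl x (hG hx)
    have h2 : l x ≠ c := fun h => hxF ⟨hG hx, h⟩
    exact sub_pos.2 (lt_of_le_of_ne h1 h2)
  obtain ⟨y, hy, hyc⟩ := extra htP.subset hFt
  obtain ⟨z, hz, hzc⟩ := extra hsP.subset hFs
  have hne : {x ∈ P | m x - d = t * (c - l x)} ≠ {x ∈ P | -m x - -d = s * (c - l x)} := by
    intro h
    have h1 := hy.2
    rw [h] at hy
    have h2 := hy.2
    have h3 : (t + s) * (c - l y) = 0 := by linarith
    have h4 : t + s = 0 := (mul_eq_zero.1 h3).resolve_right hyc.ne'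
    -- If the two faces coincided, then `s = -t`, and the two inequalities would squeeze `m - d` to
    -- the multiple `t * (c - l)`.
    refine hlm ⟨t, fun x hx => le_antisymm (ht x hx) ?_⟩
    have h5 := hs x hx
    obtain rfl : s = -t := by linarith
    linarith
  rw [Set.ncard_eq_two]
  refine ⟨_, _, hne, Set.Subset.antisymm ?_ ?_⟩
  · rintro G ⟨hG, hFG, hGP⟩
    obtain ⟨k, e, hk, hGk⟩ := hG.exists_functional
    obtain ⟨w, hw, hwc⟩ := extra hGP.subset hFG
    have hwk : k w = e := (hGk ▸ hw : w ∈ {x ∈ P | k x = e}).2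
    obtain ⟨a, b, hab⟩ := hspan k e (fun x hx h =>
      (hGk ▸ hFG.subset ⟨hx, h⟩ : x ∈ {x ∈ P | k x = e}).2) ⟨w, hGP.subset hw, hwk⟩
    have hwab := hab w (hGP.subset hw)
    rw [hwk, sub_self] at hwab
    -- The sign of `b` tells which way the hyperplane of `G` was rotated; dividing by `|b|` leaves a
    -- slope that must be the extremal one. For `b = 0` the point `w` of `G` off the contact face
    -- forces `a = 0`, so `G = P`.
    rcases lt_trichotomy b 0 with hb | hb | hb
    · left
      have hle : ∀ x ∈ P, m x - d ≤ (a / -b) * (c - l x) := fun x hx => by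
        have h1 := hab x hx
        have h2 := hk x hx
        rw [div_mul_eq_mul_div, le_div_iff₀ (by linarith)]
        linarith
      have heq : t = a / -b := eq_of_pencil_ratio (f := fun x => c - l x) (g := fun x => m x - d)
        ht hle ⟨y, hy.1, hyc, hy.2⟩ ⟨w, hGP.subset hw, hwc, by
          rw [div_mul_eq_mul_div, eq_div_iff (by linarith)]; linarith⟩
      rw [hGk, heq]
      ext x
      refine and_congr_right fun hx => ?_
      rw [div_mul_eq_mul_div, eq_div_iff (by linarith)]
      have := hab x hx
      exact ⟨fun h => by linarith, fun h => by linarith⟩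
    · exfalso
      subst hb
      have ha : a = 0 := by
        rw [zero_mul, add_zero] at hwab
        exact (mul_eq_zero.1 hwab.symm).resolve_right hwc.ne'
      refine hGP.ne (hGP.subset.antisymm fun x hx => ?_)
      rw [hGk]
      refine ⟨hx, ?_⟩
      have := hab x hx
      rw [ha] at this
      linarith
    · right
      have hle : ∀ x ∈ P, -m x - -d ≤ (a / b) * (c - l x) := fun x hx => by
        have h1 := hab x hx
        have h2 := hk x hx
        rw [div_mul_eq_mul_div, le_div_iff₀ hb]
        linarith
      have heq : s = a / b := eq_of_pencil_ratio (f := fun x => c - l x) (g := fun x => -m x - -d)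
        hs hle ⟨z, hz.1, hzc, hz.2⟩ ⟨w, hGP.subset hw, hwc, by
          rw [div_mul_eq_mul_div, eq_div_iff hb.ne']; linarith⟩
      rw [Set.mem_singleton_iff, hGk, heq]
      ext x
      refine and_congr_right fun hx => ?_
      rw [div_mul_eq_mul_div, eq_div_iff hb.ne']
      have := hab x hx
      exact ⟨fun h => by linarith, fun h => by linarith⟩
  · rintro G (rfl | rfl)
    · exact ⟨hGt, hFt, htP⟩
    · exact ⟨hGs, hFs, hsP⟩

theorem sub_eq_of_le_ker {P : Set E} {k : E →ₗ[ℝ] ℝ} (hk : vectorSpan ℝ P ≤ LinearMap.ker k)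
    {x y : E} (hx : x ∈ P) (hy : y ∈ P) : k x = k y := by
  have : k (x - y) = 0 := hk (vsub_mem_vectorSpan ℝ hx hy)
  rwa [map_sub, sub_eq_zero] at this

/-- A face of codimension at least two has a supporting functional `l` and a second functional `m`,
constant on the face, that is independent of `l`. -/
theorem IsFace.exists_independent {P F : Set E} (hF : IsFace P F)
    (hd : polyDim F + 2 ≤ polyDim P) :
    ∃ (l m : E →ₗ[ℝ] ℝ) (c d : ℝ), (∀ x ∈ P, l x ≤ c) ∧ F = {x ∈ P | l x = c} ∧
      (∀ x ∈ P, l x = c → m x = d) ∧ ∃ u ∈ vectorSpan ℝ P, ∃ w ∈ vectorSpan ℝ P,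
        l u = 0 ∧ m u ≠ 0 ∧ l w ≠ 0 := by
  obtain ⟨l, c, hl, hFl⟩ := hF.exists_functional
  have hFc : ∀ x ∈ F, l x = c := fun x hx => (hFl ▸ hx : x ∈ {x ∈ P | l x = c}).2
  obtain ⟨x₀, hx₀⟩ := hF.1
  obtain ⟨w, hw, hlw⟩ : ∃ w ∈ vectorSpan ℝ P, l w ≠ 0 := by
    by_contra! h
    have hFP : F = P := hF.subset.antisymm fun x hx => by
      rw [hFl]
      exact ⟨hx, (sub_eq_of_le_ker h hx (hF.subset hx₀)).trans (hFc x₀ hx₀)⟩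
    rw [hFP] at hd
    omega
  -- The kernel of `l` loses at most one dimension of `vectorSpan ℝ P`, so codimension two leaves a
  -- direction outside that of `F`.
  obtain ⟨u, ⟨huP, hlu⟩, huF⟩ : ∃ u ∈ vectorSpan ℝ P ⊓ LinearMap.ker l, u ∉ vectorSpan ℝ F := by
    by_contra! h
    have h1 : Module.finrank ℝ ↥(vectorSpan ℝ P ⊓ LinearMap.ker l) ≤ polyDim F :=
      Submodule.finrank_mono h
    have h2 := Submodule.finrank_sup_add_finrank_inf_eq (vectorSpan ℝ P) (LinearMap.ker l)
    have h3 : Module.finrank ℝ ↥(vectorSpan ℝ P ⊔ LinearMap.ker l) ≤ Module.finrank ℝ E :=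
      Submodule.finrank_le _
    have h4 := LinearMap.finrank_range_add_finrank_ker l
    have h5 : Module.finrank ℝ (LinearMap.range l) ≤ 1 := by
      simpa using Submodule.finrank_le (LinearMap.range l)
    have h6 : Module.finrank ℝ (vectorSpan ℝ P) = polyDim P := rfl
    omega
  obtain ⟨m, hmu, hmF⟩ := Submodule.exists_le_ker_of_notMem huF
  refine ⟨l, m, c, m x₀, hl, hFl, fun x hx hxc => ?_, u, huP, w, hw, hlu, hmu, hlw⟩
  exact sub_eq_of_le_ker hmF (hFl ▸ ⟨hx, hxc⟩) hx₀

/-- Proportionality would make `m + t • l` vanish on all directions of `P`, but at `u` its value is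
`m u`. -/
theorem not_proportional {P : Set E} {l m : E →ₗ[ℝ] ℝ} {c d : ℝ} {u : E}
    (hu : u ∈ vectorSpan ℝ P) (hlu : l u = 0) (hmu : m u ≠ 0) :
    ¬ ∃ t : ℝ, ∀ x ∈ P, m x - d = t * (c - l x) := by
  rintro ⟨t, ht⟩
  have h : vectorSpan ℝ P ≤ LinearMap.ker (m + t • l) :=
    vectorSpan_le_ker (c := d + t * c) fun x hx => by
      have := ht x hx
      simp only [LinearMap.add_apply, LinearMap.smul_apply, smul_eq_mul]
      linarith
  have h2 := h hu
  simp [hlu] at h2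
  exact hmu h2

theorem IsFace.exists_between {P F : Set E} (hP : IsPolytope P) (hF : IsFace P F)
    (hd : polyDim F + 2 ≤ polyDim P) : ∃ G, IsFace P G ∧ F ⊂ G ∧ G ⊂ P := by
  obtain ⟨l, m, c, d, hl, rfl, hm, u, hu, w, hw, hlu, hmu, hlw⟩ := hF.exists_independent hd
  obtain ⟨t, -, h⟩ := exists_rotation hP hl hm (not_proportional hu hlu hmu)
  exact ⟨_, h⟩

/-- The diamond property. -/
theorem IsFace.ncard_between {P F : Set E} (hP : IsPolytope P) (hF : IsFace P F)
    (hd : polyDim P = polyDim F + 2) : {G | IsFace P G ∧ F ⊂ G ∧ G ⊂ P}.ncard = 2 := by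
  obtain ⟨l, m, c, d, hl, hFl, hm, u, hu, w, hw, hlu, hmu, hlw⟩ := hF.exists_independent hd.ge
  obtain ⟨x₀, hx₀⟩ := hF.1
  have hx₀' := hFl ▸ hx₀
  have hvF : vectorSpan ℝ F ≤ LinearMap.ker l ⊓ LinearMap.ker m :=
    le_inf (vectorSpan_le_ker (c := c) fun x hx => (hFl ▸ hx : x ∈ {x ∈ P | l x = c}).2)
      (vectorSpan_le_ker (c := d) fun x hx => by
        rw [hFl] at hx
        exact hm x hx.1 hx.2)
  -- Each of the two kernels strictly lowers the dimension, which accounts for the whole codimension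
  -- of `F`.
  have hker : vectorSpan ℝ F = vectorSpan ℝ P ⊓ LinearMap.ker l ⊓ LinearMap.ker m := by
    refine Submodule.eq_of_le_of_finrank_le
      (le_inf (le_inf (vectorSpan_mono ℝ hF.subset) (hvF.trans inf_le_left))
        (hvF.trans inf_le_right)) ?_
    have h1 : vectorSpan ℝ P ⊓ LinearMap.ker l ⊓ LinearMap.ker m
        < vectorSpan ℝ P ⊓ LinearMap.ker l :=
      inf_lt_left.2 fun h => hmu (h ⟨hu, hlu⟩)
    have h2 : vectorSpan ℝ P ⊓ LinearMap.ker l < vectorSpan ℝ P :=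
      inf_lt_left.2 fun h => hlw (h hw)
    have h3 := Submodule.finrank_lt_finrank_of_lt h1
    have h4 := Submodule.finrank_lt_finrank_of_lt h2
    unfold polyDim at hd
    omega
  rw [hFl]
  refine ncard_faces_of_pencil hP hl hm (not_proportional hu hlu hmu) fun k e hk _ => ?_
  have hkF : vectorSpan ℝ F ≤ LinearMap.ker k :=
    vectorSpan_le_ker (c := e) fun x hx => hk x (hF.subset hx) (hFl ▸ hx :
      x ∈ {x ∈ P | l x = c}).2
  -- A functional constant on `F` vanishes on that common kernel, so on the directions of `P` it is
  -- a combination of `l` and `m`; evaluating at `u`, where `l` vanishes, and then at `w` gives the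
  -- coefficients.
  set b := k u / m u with hb
  set a := (k w - b * m w) / l w with ha
  have hval : ∀ y ∈ vectorSpan ℝ P, k y = a * l y + b * m y := by
    intro y hy
    set β := l y / l w with hβ
    set α := m (y - β • w) / m u with hα
    have hmem : y - β • w - α • u ∈ vectorSpan ℝ F := by
      rw [hker]
      refine ⟨⟨sub_mem (sub_mem hy (Submodule.smul_mem _ _ hw)) (Submodule.smul_mem _ _ hu), ?_⟩, ?_⟩
      · change l (y - β • w - α • u) = 0
        simp [hlu, hβ, hlw]
      · change m (y - β • w - α • u) = 0
        rw [map_sub, map_smul, hα, smul_eq_mul, div_mul_cancel₀ _ hmu, sub_self]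
    have h1 : k y = β * k w + α * k u := by
      have : k (y - β • w - α • u) = 0 := hkF hmem
      rw [map_sub, map_sub, map_smul, map_smul, smul_eq_mul, smul_eq_mul] at this
      linarith
    have h2 : l y = β * l w := by rw [hβ, div_mul_cancel₀ _ hlw]
    have h3 : m y = β * m w + α * m u := by
      have : α * m u = m (y - β • w) := div_mul_cancel₀ _ hmu
      rw [this, map_sub, map_smul, smul_eq_mul]; ring
    have h4 : k u = b * m u := by rw [hb, div_mul_cancel₀ _ hmu]
    have h5 : a * l w = k w - b * m w := by rw [ha, div_mul_cancel₀ _ hlw]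
    rw [h1, h2, h3, h4]
    linear_combination -β * h5
  refine ⟨a, -b, fun x hx => ?_⟩
  have h1 := hval _ (vsub_mem_vectorSpan ℝ hx hx₀'.1)
  simp only [vsub_eq_sub, map_sub] at h1
  have h2 := hk x₀ hx₀'.1 hx₀'.2
  have h3 := hm x₀ hx₀'.1 hx₀'.2
  have h4 : l x₀ = c := hx₀'.2
  rw [h2, h3, h4] at h1
  linear_combination -h1

/-- A one-dimensional polytope has exactly two proper faces. -/
theorem ncard_proper_faces_of_segment {P : Set E} (hP : IsPolytope P) (hd : polyDim P = 1) :
    {G | IsFace P G ∧ G ⊂ P}.ncard = 2 := by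
  obtain ⟨u, hu0, hu⟩ := finrank_eq_one_iff'.1 hd
  have huE : (u : E) ∉ (⊥ : Submodule ℝ E) := by simpa using hu0
  obtain ⟨m, hmu, -⟩ := Submodule.exists_le_ker_of_notMem huE
  -- The functional `0` never takes the value `1`, so the contact face is empty and the pencil
  -- argument counts all proper nonempty faces.
  have h := ncard_faces_of_pencil (l := 0) (m := m) (c := 1) (d := 0) hP (by simp) (by simp)
    (not_proportional u.2 rfl hmu) fun k e _ ⟨x₀, hx₀, hk⟩ => ?_
  · rw [← h]
    congr 1
    ext G
    simp only [Set.mem_ofPred_eq]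
    refine and_congr_right fun hG => ⟨fun h => ⟨?_, h⟩, fun h => h.2⟩
    simpa [Set.empty_ssubset] using hG.1
  · refine ⟨k u / m u * m x₀, -(k u / m u), fun x hx => ?_⟩
    obtain ⟨r, hr⟩ := hu ⟨x - x₀, vsub_mem_vectorSpan ℝ hx hx₀⟩
    have hr' : x = x₀ + r • (u : E) := by
      rw [← sub_eq_iff_eq_add']
      exact (congrArg Subtype.val hr).symm
    rw [hr', ← hk]
    simp only [map_add, map_smul, smul_eq_mul, LinearMap.zero_apply]
    field_simp
    ring

/-- Every proper face is contained in a face of one dimension more. -/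
theorem IsFace.exists_cover {P F : Set E} (hP : IsPolytope P) (hF : IsFace P F)
    (hd : polyDim F < polyDim P) : ∃ G, IsFace P G ∧ F ⊆ G ∧ polyDim G = polyDim F + 1 := by
  induction h : polyDim P using Nat.strong_induction_on generalizing P with
  | _ n ih =>
    subst h
    rcases Nat.lt_or_ge (polyDim F + 1) (polyDim P) with h2 | h2
    · obtain ⟨G, hG, hFG, hGP⟩ := hF.exists_between hP h2
      have hFG' : IsFace G F := hF.mono hGP.subset hFG.subset
      obtain ⟨G', hG', h3⟩ := ih _ (hG.polyDim_lt hGP subset_rfl) (hG.isPolytope hP) hFG'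
        (hF.polyDim_lt hFG hGP.subset) rfl
      exact ⟨G', hG.trans hP hG', h3⟩
    · exact ⟨P, isFace_self (hF.1.mono hF.subset), hF.subset, by omega⟩

/-- Rotation about the empty contact face produces a nonempty proper face; dimension drops until it
is zero. -/
theorem exists_vertex {P : Set E} (hP : IsPolytope P) (hne : P.Nonempty) :
    ∃ F, IsFace P F ∧ polyDim F = 0 := by
  induction h : polyDim P using Nat.strong_induction_on generalizing P with
  | _ n ih =>
    subst h
    rcases Nat.eq_zero_or_pos (polyDim P) with h0 | h0
    · exact ⟨P, isFace_self hne, h0⟩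
    obtain ⟨u, hu, hu0⟩ : ∃ u ∈ vectorSpan ℝ P, u ≠ 0 := by
      rw [← Submodule.ne_bot_iff]
      intro hb
      rw [polyDim, hb, finrank_bot] at h0
      exact lt_irrefl 0 h0
    have huE : u ∉ (⊥ : Submodule ℝ E) := by simpa using hu0
    obtain ⟨m, hmu, -⟩ := Submodule.exists_le_ker_of_notMem huE
    obtain ⟨t, -, hG, -, hGP⟩ := exists_rotation (l := 0) (m := m) (c := 1) (d := 0) hP (by simp)
      (by simp) (not_proportional hu rfl hmu)
    obtain ⟨F, hF, hF0⟩ := ih _ (hG.polyDim_lt hGP subset_rfl) (hG.isPolytope hP) hG.1 rfl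
    exact ⟨F, hG.trans hP hF, hF0⟩

end Diamond

/-! ### Flag numbers of 4-polytopes -/

section Counting

open Classical in
/-- In a bipartite incidence relation in which every element is incident to exactly two elements
of the other side, both sides have the same size. -/
theorem card_eq_of_two_two {α β : Type*} (A : Finset α) (B : Finset β) (r : α → β → Prop)
    (hA : ∀ a ∈ A, (B.filter fun b => r a b).card = 2)
    (hB : ∀ b ∈ B, (A.filter fun a => r a b).card = 2) : A.card = B.card := by
  have h := Finset.sum_card_bipartiteAbove_eq_sum_card_bipartiteBelow (s := A) (t := B) r
  simp only [Finset.bipartiteAbove, Finset.bipartiteBelow] at h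
  rw [Finset.sum_congr rfl hA, Finset.sum_congr rfl hB] at h
  simpa using h

open Classical in
/-- A nonempty two-regular incidence relation without digons has at least three elements on each
side. -/
theorem three_le_card_of_two_two {α β : Type*} (A : Finset α) (B : Finset β) (r : α → β → Prop)
    (hne : A.Nonempty)
    (hA : ∀ a ∈ A, (B.filter fun b => r a b).card = 2)
    (hB : ∀ b ∈ B, (A.filter fun a => r a b).card = 2)
    (hr : ∀ a ∈ A, ∀ a' ∈ A, ∀ b ∈ B, ∀ b' ∈ B, r a b → r a b' → r a' b → r a' b' → a ≠ a' →
      b = b') : 3 ≤ A.card := by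
  obtain ⟨a, ha⟩ := hne
  obtain ⟨b₁, b₂, hb, hab⟩ := Finset.card_eq_two.1 (hA a ha)
  have hb₁ : b₁ ∈ B ∧ r a b₁ := Finset.mem_filter.1 (hab ▸ by simp)
  have hb₂ : b₂ ∈ B ∧ r a b₂ := Finset.mem_filter.1 (hab ▸ by simp)
  have other : ∀ b ∈ B, ∃ a' ∈ A, r a' b ∧ a' ≠ a := by
    intro b hb
    obtain ⟨a', ha', hne⟩ := Finset.exists_mem_ne (by rw [hB b hb]; norm_num) a
    rw [Finset.mem_filter] at ha'
    exact ⟨a', ha'.1, ha'.2, hne⟩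
  obtain ⟨a₁, ha₁, hr₁, hne₁⟩ := other b₁ hb₁.1
  obtain ⟨a₂, ha₂, hr₂, hne₂⟩ := other b₂ hb₂.1
  -- The neighbours of `a` across `b₁` and `b₂` differ, since otherwise they would form a digon with
  -- `a`.
  have h12 : a₁ ≠ a₂ := by
    rintro rfl
    exact hb (hr a ha a₁ ha₁ b₁ hb₁.1 b₂ hb₂.1 hb₁.2 hb₂.2 hr₁ hr₂ hne₁.symm)
  have h3 : ({a, a₁, a₂} : Finset α).card = 3 := by
    rw [Finset.card_eq_three]
    exact ⟨a, a₁, a₂, hne₁.symm, hne₂.symm, h12, rfl⟩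
  rw [← h3]
  refine Finset.card_le_card fun x hx => ?_
  simp only [Finset.mem_insert, Finset.mem_singleton] at hx
  rcases hx with rfl | rfl | rfl <;> assumption

end Counting

section Flags

variable {E : Type*} [NormedAddCommGroup E] [NormedSpace ℝ E] [FiniteDimensional ℝ E]

set_option linter.unusedSectionVars false

theorem finite_faces_of_dim {P : Set E} (hP : IsPolytope P) (k : ℕ) :
    {F | IsFaceOfDim P k F}.Finite :=
  (finite_faces hP).subset fun _ hF => (isFaceOfDim_iff.1 hF).1

/-- The finite set of `k`-dimensional faces of a polytope. -/
noncomputable def faceFinset {P : Set E} (hP : IsPolytope P) (k : ℕ) : Finset (Set E) :=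
  (finite_faces_of_dim hP k).toFinset

theorem mem_faceFinset {P F : Set E} {hP : IsPolytope P} {k : ℕ} :
    F ∈ faceFinset hP k ↔ IsFace P F ∧ polyDim F = k := by
  simp [faceFinset, isFaceOfDim_iff]

theorem flagNumber_singleton {d : ℕ} (i : Fin d) (P : Set E) :
    flagNumber {i} P = {F | IsFaceOfDim P i F}.ncard := by
  unfold flagNumber
  symm
  refine Set.ncard_congr (fun F _ _ => F) (fun F hF => ⟨fun a b hab => ?_, fun j => ?_⟩)
    (fun F G _ _ h => congrFun h ⟨i, Finset.mem_singleton_self i⟩) (fun f hf => ?_)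
  · have ha := Finset.mem_singleton.1 a.2
    have hb := Finset.mem_singleton.1 b.2
    exact absurd hab (by rw [Subtype.ext (ha.trans hb.symm)]; exact lt_irrefl b)
  · obtain ⟨j, hj⟩ := j
    obtain rfl := Finset.mem_singleton.1 hj
    exact hF
  · refine ⟨f ⟨i, Finset.mem_singleton_self i⟩, hf.2 _, funext fun j => ?_⟩
    obtain ⟨j, hj⟩ := j
    obtain rfl := Finset.mem_singleton.1 hj
    rfl

theorem flagNumber_pair {d : ℕ} {i j : Fin d} (hij : i < j) (P : Set E) :
    flagNumber {i, j} P =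
      {p : Set E × Set E | IsFaceOfDim P i p.1 ∧ IsFaceOfDim P j p.2 ∧ p.1 ⊆ p.2}.ncard := by
  unfold flagNumber
  have hi : i ∈ ({i, j} : Finset (Fin d)) := by simp
  have hj : j ∈ ({i, j} : Finset (Fin d)) := by simp
  have hmem : ∀ k : {k // k ∈ ({i, j} : Finset (Fin d))}, k = ⟨i, hi⟩ ∨ k = ⟨j, hj⟩ := by
    rintro ⟨k, hk⟩
    rw [Finset.mem_insert, Finset.mem_singleton] at hk
    simpa using hk
  refine Set.ncard_congr (fun f _ => (f ⟨i, hi⟩, f ⟨j, hj⟩)) (fun f hf => ?_) (fun f g _ _ h => ?_)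
    (fun p hp => ?_)
  · have hlt : (⟨i, hi⟩ : {k // k ∈ ({i, j} : Finset (Fin d))}) < ⟨j, hj⟩ := hij
    exact ⟨hf.2 _, hf.2 _, (hf.1 hlt).le⟩
  · funext k
    rcases hmem k with rfl | rfl
    · exact congrArg Prod.fst h
    · exact congrArg Prod.snd h
  · obtain ⟨F, G⟩ := p
    obtain ⟨hF, hG, hFG⟩ := hp
    have hlt : F < G := by
      refine lt_of_le_of_ne hFG fun h => ?_
      have h1 : polyDim F = i := hF.2.2
      have h2 : polyDim G = j := hG.2.2
      have h3 : (i : ℕ) < j := hij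
      change F = G at h
      rw [h] at h1
      omega
    refine ⟨fun k => if k.1 = i then F else G, ⟨fun a b hab => ?_, fun k => ?_⟩, ?_⟩
    · rcases hmem a with rfl | rfl <;> rcases hmem b with rfl | rfl
      · exact absurd hab (lt_irrefl _)
      · simpa [hij.ne'] using hlt
      · exact absurd hab hij.asymm
      · exact absurd hab (lt_irrefl _)
    · rcases hmem k with rfl | rfl
      · simpa using hF
      · simpa [hij.ne'] using hG
    · simp [hij.ne']

theorem flagNumber_singleton_eq_card {d : ℕ} {P : Set E} (hP : IsPolytope P) (i : Fin d) :
    flagNumber {i} P = (faceFinset hP i).card := by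
  rw [flagNumber_singleton, Set.ncard_eq_toFinset_card _ (finite_faces_of_dim hP i)]
  rfl

open Classical in
/-- The number of incident pairs of an `i`-face and a `j`-face, sorted by the `j`-face. -/
theorem flagNumber_pair_eq_sum {d : ℕ} {P : Set E} (hP : IsPolytope P) {i j : Fin d} (hij : i < j) :
    flagNumber {i, j} P =
      ∑ G ∈ faceFinset hP j, ((faceFinset hP i).filter fun F => F ⊆ G).card := by
  have h : {p : Set E × Set E | IsFaceOfDim P i p.1 ∧ IsFaceOfDim P j p.2 ∧ p.1 ⊆ p.2} =
      (((faceFinset hP i ×ˢ faceFinset hP j).filter fun p => p.1 ⊆ p.2 : Finset _) :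
        Set (Set E × Set E)) := by
    ext p
    simp [mem_faceFinset, isFaceOfDim_iff, and_assoc]
  rw [flagNumber_pair hij, h, Set.ncard_coe_finset, Finset.card_filter, Finset.sum_product_right]
  simp only [Finset.card_filter]

open Classical in
theorem flagNumber_pair_eq_sum' {d : ℕ} {P : Set E} (hP : IsPolytope P) {i j : Fin d} (hij : i < j) :
    flagNumber {i, j} P =
      ∑ F ∈ faceFinset hP i, ((faceFinset hP j).filter fun G => F ⊆ G).card := by
  rw [flagNumber_pair_eq_sum hP hij]
  exact (Finset.sum_card_bipartiteAbove_eq_sum_card_bipartiteBelow (fun F G : Set E => F ⊆ G)).symm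

/-- Two distinct faces of equal dimension share at most one face of one dimension less. -/
theorem eq_of_common_facets {P X Y Z W : Set E} {k : ℕ} (hX : IsFace P X) (hY : IsFace P Y)
    (hZ : IsFace P Z) (hW : IsFace P W) (hXd : polyDim X = k + 1) (hYd : polyDim Y = k + 1)
    (hZd : polyDim Z = k) (hWd : polyDim W = k) (hZX : Z ⊆ X) (hZY : Z ⊆ Y) (hWX : W ⊆ X)
    (hWY : W ⊆ Y) (hXY : X ≠ Y) : Z = W := by
  -- The intersection is a face of dimension at most `k`, so each `k`-face inside it fills it.
  have hI : IsFace P (X ∩ Y) := hX.inter hY (hZ.1.mono (Set.subset_inter hZX hZY))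
  have hlt : polyDim (X ∩ Y) < polyDim X := by
    refine hI.polyDim_lt (Set.inter_subset_left.ssubset_of_ne fun h => hXY ?_) hX.subset
    rw [Set.inter_eq_left] at h
    exact hX.eq_of_polyDim_le h hY.subset (by omega)
  have h1 := hZ.eq_of_polyDim_le (Set.subset_inter hZX hZY) hI.subset (by omega)
  have h2 := hW.eq_of_polyDim_le (Set.subset_inter hWX hWY) hI.subset (by omega)
  rw [h1, h2]

open Classical in
/-- The diamond property inside a polytope, as a count of faces of the intermediate dimension. -/
theorem card_faces_between {P F G : Set E} (hP : IsPolytope P) (hF : IsFace P F) (hG : IsFace P G)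
    (hFG : F ⊆ G) {k : ℕ} (hFd : polyDim F = k) (hGd : polyDim G = k + 2) :
    ((faceFinset hP (k + 1)).filter fun X => F ⊆ X ∧ X ⊆ G).card = 2 := by
  have h := (hF.mono hG.subset hFG).ncard_between (hG.isPolytope hP) (by omega)
  rw [← h, ← Set.ncard_coe_finset]
  congr 1
  ext X
  simp only [Finset.coe_filter, mem_faceFinset, Set.mem_ofPred_eq]
  constructor
  · rintro ⟨⟨hX, hXd⟩, hFX, hXG⟩
    refine ⟨hX.mono hG.subset hXG, hFX.ssubset_of_ne ?_, hXG.ssubset_of_ne ?_⟩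
    · rintro rfl; omega
    · rintro rfl; omega
  · rintro ⟨hX, hFX, hXG⟩
    have hX' := hG.trans hP hX
    have h1 := hF.polyDim_lt hFX hX'.subset
    have h2 := hX'.polyDim_lt hXG hG.subset
    exact ⟨⟨hX', by omega⟩, hFX.subset, hXG.subset⟩

open Classical in
theorem card_vertices_of_edge {P G : Set E} (hP : IsPolytope P) (hG : IsFace P G)
    (hGd : polyDim G = 1) : ((faceFinset hP 0).filter fun X => X ⊆ G).card = 2 := by
  have h := ncard_proper_faces_of_segment (hG.isPolytope hP) hGd
  rw [← h, ← Set.ncard_coe_finset]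
  congr 1
  ext X
  simp only [Finset.coe_filter, mem_faceFinset, Set.mem_ofPred_eq]
  constructor
  · rintro ⟨⟨hX, hXd⟩, hXG⟩
    refine ⟨hX.mono hG.subset hXG, hXG.ssubset_of_ne ?_⟩
    rintro rfl; omega
  · rintro ⟨hX, hXG⟩
    have hX' := hG.trans hP hX
    have h2 := hX'.polyDim_lt hXG hG.subset
    exact ⟨⟨hX', by omega⟩, hXG.subset⟩

open Classical in
/-- A polygon has as many vertices as edges, and at least three. -/
theorem polygon_vertices_edges {P R : Set E} (hP : IsPolytope P) (hR : IsFace P R)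
    (hRd : polyDim R = 2) :
    ((faceFinset hP 0).filter fun F => F ⊆ R).card =
        ((faceFinset hP 1).filter fun F => F ⊆ R).card ∧
      3 ≤ ((faceFinset hP 0).filter fun F => F ⊆ R).card := by
  have hA : ∀ a ∈ (faceFinset hP 0).filter fun F => F ⊆ R,
      (((faceFinset hP 1).filter fun F => F ⊆ R).filter fun b => a ⊆ b).card = 2 := by
    intro a ha
    rw [Finset.mem_filter, mem_faceFinset] at ha
    rw [Finset.filter_filter, ← card_faces_between hP ha.1.1 hR ha.2 ha.1.2 hRd]
    simp only [and_comm, zero_add]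
  have hB : ∀ b ∈ (faceFinset hP 1).filter fun F => F ⊆ R,
      (((faceFinset hP 0).filter fun F => F ⊆ R).filter fun a => a ⊆ b).card = 2 := by
    intro b hb
    rw [Finset.mem_filter, mem_faceFinset] at hb
    rw [Finset.filter_filter, ← card_vertices_of_edge hP hb.1.1 hb.1.2]
    congr 1
    refine Finset.filter_congr fun X _ => ⟨fun h => h.2, fun h => ⟨h.trans hb.2, h⟩⟩
  refine ⟨card_eq_of_two_two _ _ (· ⊆ ·) hA hB, three_le_card_of_two_two _ _ (· ⊆ ·) ?_ hA hB ?_⟩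
  · obtain ⟨v, hv, hv0⟩ := exists_vertex (hR.isPolytope hP) hR.1
    exact ⟨v, Finset.mem_filter.2 ⟨mem_faceFinset.2 ⟨hR.trans hP hv, hv0⟩, hv.subset⟩⟩
  · intro a ha a' ha' b hb b' hb' h1 h2 h3 h4 hne
    simp only [Finset.mem_filter, mem_faceFinset] at ha ha' hb hb'
    by_contra h
    exact hne (eq_of_common_facets hb.1.1 hb'.1.1 ha.1.1 ha'.1.1 hb.1.2 hb'.1.2 ha.1.2 ha'.1.2
      h1 h2 h3 h4 h)

open Classical in
/-- An edge of a 4-polytope lies in as many 2-faces as facets, and in at least three. -/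
theorem edge_twoFaces_facets {P e : Set E} (hP : IsPolytope P) (hPd : polyDim P = 4)
    (he : IsFace P e) (hed : polyDim e = 1) :
    ((faceFinset hP 2).filter fun F => e ⊆ F).card =
        ((faceFinset hP 3).filter fun F => e ⊆ F).card ∧
      3 ≤ ((faceFinset hP 2).filter fun F => e ⊆ F).card := by
  have hPP : IsFace P P := isFace_self (he.1.mono he.subset)
  have hA : ∀ a ∈ (faceFinset hP 2).filter fun F => e ⊆ F,
      (((faceFinset hP 3).filter fun F => e ⊆ F).filter fun b => a ⊆ b).card = 2 := by
    intro a ha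
    rw [Finset.mem_filter, mem_faceFinset] at ha
    rw [Finset.filter_filter, ← card_faces_between hP ha.1.1 hPP ha.1.1.subset ha.1.2 hPd]
    congr 1
    refine Finset.filter_congr fun X hX => ⟨fun h => ⟨h.2, ?_⟩, fun h => ⟨ha.2.trans h.1, h.1⟩⟩
    exact (mem_faceFinset.1 hX).1.subset
  have hB : ∀ b ∈ (faceFinset hP 3).filter fun F => e ⊆ F,
      (((faceFinset hP 2).filter fun F => e ⊆ F).filter fun a => a ⊆ b).card = 2 := by
    intro b hb
    rw [Finset.mem_filter, mem_faceFinset] at hb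
    rw [Finset.filter_filter]
    exact card_faces_between hP he hb.1.1 hb.2 hed hb.1.2
  refine ⟨card_eq_of_two_two _ _ (· ⊆ ·) hA hB, three_le_card_of_two_two _ _ (· ⊆ ·) ?_ hA hB ?_⟩
  · obtain ⟨R, hR, heR, hRd⟩ := he.exists_cover hP (by omega)
    exact ⟨R, Finset.mem_filter.2 ⟨mem_faceFinset.2 ⟨hR, by omega⟩, heR⟩⟩
  · intro a ha a' ha' b hb b' hb' h1 h2 h3 h4 hne
    simp only [Finset.mem_filter, mem_faceFinset] at ha ha' hb hb'
    by_contra h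
    exact hne (eq_of_common_facets hb.1.1 hb'.1.1 ha.1.1 ha'.1.1 hb.1.2 hb'.1.2 ha.1.2 ha'.1.2
      h1 h2 h3 h4 h)

/-- Sorted by the 2-face, both sides agree polygon by polygon. -/
theorem flagNumber_zero_two_eq_one_two {d : ℕ} {P : Set E} (hP : IsPolytope P) (h : 2 < d) :
    flagNumber ({⟨0, by omega⟩, ⟨2, h⟩} : Finset (Fin d)) P =
      flagNumber ({⟨1, by omega⟩, ⟨2, h⟩} : Finset (Fin d)) P := by
  classical
  rw [flagNumber_pair_eq_sum hP (by simp), flagNumber_pair_eq_sum hP (by simp)]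
  refine Finset.sum_congr rfl fun R hR => ?_
  rw [mem_faceFinset] at hR
  exact (polygon_vertices_edges hP hR.1 hR.2).1

/-- The dual count, sorted by the edge. -/
theorem flagNumber_one_two_eq_one_three {P : Set E} (hP : IsPolytope P) (hPd : polyDim P = 4) :
    flagNumber ({1, 2} : Finset (Fin 4)) P = flagNumber ({1, 3} : Finset (Fin 4)) P := by
  classical
  rw [flagNumber_pair_eq_sum' hP (by decide), flagNumber_pair_eq_sum' hP (by decide)]
  refine Finset.sum_congr rfl fun e he => ?_
  rw [mem_faceFinset] at he
  exact (edge_twoFaces_facets hP hPd he.1 he.2).1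

theorem ellOne_nonneg {P : Set E} (hP : IsPolytope P) : 0 ≤ ellOne P := by
  classical
  have h : flagNumber ({2} : Finset (Fin 4)) P * 3 ≤ flagNumber ({0, 2} : Finset (Fin 4)) P := by
    rw [flagNumber_pair_eq_sum hP (by decide), flagNumber_singleton_eq_card hP]
    rw [← smul_eq_mul]
    refine Finset.card_nsmul_le_sum _ _ _ fun R hR => ?_
    rw [mem_faceFinset] at hR
    exact (polygon_vertices_edges hP hR.1 hR.2).2
  have h' : (flagNumber ({2} : Finset (Fin 4)) P : ℝ) * 3 ≤
      flagNumber ({0, 2} : Finset (Fin 4)) P := by exact_mod_cast h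
  unfold ellOne
  linarith

theorem ellTwo_nonneg {P : Set E} (hP : IsPolytope P) (hPd : polyDim P = 4) : 0 ≤ ellTwo P := by
  classical
  have h : flagNumber ({1} : Finset (Fin 4)) P * 3 ≤ flagNumber ({1, 3} : Finset (Fin 4)) P := by
    rw [← flagNumber_one_two_eq_one_three hP hPd, flagNumber_pair_eq_sum' hP (by decide),
      flagNumber_singleton_eq_card hP]
    rw [← smul_eq_mul]
    refine Finset.card_nsmul_le_sum _ _ _ fun e he => ?_
    rw [mem_faceFinset] at he
    exact (edge_twoFaces_facets hP hPd he.1 he.2).2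
  have h' : (flagNumber ({1} : Finset (Fin 4)) P : ℝ) * 3 ≤
      flagNumber ({1, 3} : Finset (Fin 4)) P := by exact_mod_cast h
  unfold ellTwo
  linarith

theorem flagEval_alphaFunctional (P : Set E) :
    flagEval alphaFunctional P =
      (flagNumber ({0, 2} : Finset (Fin 4)) P : ℝ) -
        3 / 2 * ((flagNumber ({1} : Finset (Fin 4)) P : ℝ) +
          (flagNumber ({2} : Finset (Fin 4)) P : ℝ)) := by
  simp [flagEval, alphaFunctional, sub_mul, add_mul, mul_add, Finset.sum_sub_distrib,
    Finset.sum_add_distrib, Pi.single_apply]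

theorem flagEval_alphaFunctional_eq_ell {P : Set E} (hP : IsPolytope P) (hPd : polyDim P = 4) :
    flagEval alphaFunctional P = (ellOne P + ellTwo P) / 2 := by
  have h : flagNumber ({0, 2} : Finset (Fin 4)) P = flagNumber ({1, 3} : Finset (Fin 4)) P :=
    (flagNumber_zero_two_eq_one_two hP (by norm_num)).trans
      (flagNumber_one_two_eq_one_three hP hPd)
  rw [flagEval_alphaFunctional, ellOne, ellTwo, ← h]
  ring

theorem IsPolytopeOfDim.isPolytope {d : ℕ} {P : Set E} (h : IsPolytopeOfDim d P) :
    IsPolytope P := by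
  obtain ⟨-, ⟨s, hs, rfl⟩, -⟩ := h
  exact ⟨hs.toFinset, by simp⟩

end Flags

/-! ### Polytopes with a given vertex-facet incidence -/

/-- `P` is the convex hull of the points `v i` and the unit ball of the gauge `max_j (l j)` on its
linear span, and `R` records which inequalities `l j ≤ 1` are tight at which `v i`. -/
structure Realization {E ι κ : Type*} [AddCommGroup E] [Module ℝ E] (P : Set E)
    (R : ι → κ → Bool) (v : ι → E) (l : κ → E →ₗ[ℝ] ℝ) : Prop where
  hull : P = convexHull ℝ (Set.range v)
  le_one : ∀ i j, l j (v i) ≤ 1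
  tight : ∀ i j, R i j = true ↔ l j (v i) = 1
  -- This makes the maximum of the `l j x` non-negative, hence a legitimate scaling factor when
  -- direct sums are formed.
  exists_nonneg : ∀ x ∈ Submodule.span ℝ P, ∃ j, 0 ≤ l j x
  -- The case `s = 1` is the description by inequalities and yields `0 ∈ P`; the case `s = 0`
  -- excludes unbounded directions.
  gauge : ∀ x ∈ Submodule.span ℝ P, ∀ s : ℝ, 0 ≤ s → (∀ j, l j x ≤ s) → x ∈ s • P

/-- `P` has the vertex-facet incidence `R`. -/
def Realizes {E ι κ : Type*} [AddCommGroup E] [Module ℝ E] (P : Set E) (R : ι → κ → Bool) : Prop :=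
  ∃ v l, Realization P R v l

section RealizationFaces

variable {E ι κ : Type*} [NormedAddCommGroup E] [NormedSpace ℝ E] [FiniteDimensional ℝ E]
  {P : Set E} {R : ι → κ → Bool} {v : ι → E} {l : κ → E →ₗ[ℝ] ℝ}

set_option linter.unusedSectionVars false

theorem Realizes.reindex {ι' κ' : Type*} (h : Realizes P R) (R' : ι' → κ' → Bool) (σ : ι' → ι)
    (τ : κ' → κ) (hσ : Function.Surjective σ) (hτ : Function.Surjective τ)
    (hR : ∀ i j, R' i j = R (σ i) (τ j)) : Realizes P R' := by
  obtain ⟨v, l, h⟩ := h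
  refine ⟨v ∘ σ, l ∘ τ, ?_, fun i j => h.le_one _ _, fun i j => ?_, fun x hx => ?_,
    fun x hx s hs hl => ?_⟩
  · rw [hσ.range_comp]; exact h.hull
  · rw [hR]; exact h.tight _ _
  · obtain ⟨j, hj⟩ := h.exists_nonneg x hx
    obtain ⟨j, rfl⟩ := hτ j
    exact ⟨j, hj⟩
  · refine h.gauge x hx s hs fun j => ?_
    obtain ⟨j, rfl⟩ := hτ j
    exact hl j

theorem Realization.zero_mem (h : Realization P R v l) : (0 : E) ∈ P := by
  have := h.gauge 0 (Submodule.zero_mem _) 1 zero_le_one (by simp)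
  rwa [one_smul] at this

theorem Realization.le_one_of_mem (h : Realization P R v l) (j : κ) : ∀ x ∈ P, l j x ≤ 1 := by
  intro x hx
  rw [h.hull] at hx
  refine le_of_mem_convexHull ?_ x hx
  rintro _ ⟨i, rfl⟩
  exact h.le_one i j

theorem Realization.mem (h : Realization P R v l) (i : ι) : v i ∈ P := by
  rw [h.hull]
  exact subset_convexHull ℝ _ ⟨i, rfl⟩

theorem Realization.mem_iff (h : Realization P R v l) {x : E} (hx : x ∈ Submodule.span ℝ P) :
    x ∈ P ↔ ∀ j, l j x ≤ 1 := by
  refine ⟨fun hx j => h.le_one_of_mem j x hx, fun hl => ?_⟩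
  simpa using h.gauge x hx 1 zero_le_one hl

theorem Realization.convex (h : Realization P R v l) : Convex ℝ P := by
  rw [h.hull]
  exact convex_convexHull ℝ _

theorem Realization.isPolytope [Finite ι] (h : Realization P R v l) : IsPolytope P :=
  ⟨(Set.finite_range v).toFinset, by simpa using h.hull⟩

theorem IsFace.convex {F : Set E} (hP : Convex ℝ P) (hF : IsFace P F) : Convex ℝ F :=
  hF.2.convex hP

/-- Every face is cut out by the inequalities that are tight on it. -/
theorem Realization.face_eq [Finite κ] (h : Realization P R v l) {F : Set E} (hF : IsFace P F) :
    F = {x ∈ P | ∀ j ∈ {j | ∀ y ∈ F, l j y = 1}, l j x = 1} := by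
  classical
  have := Fintype.ofFinite κ
  refine Set.Subset.antisymm (fun x hx => ⟨hF.subset hx, fun j hj => hj x hx⟩) ?_
  -- Averaging points of `F` gives a relatively interior one, where every inequality not tight on
  -- all of `F` is strict.
  have hint : ∀ S : Finset κ, ∃ x ∈ F, ∀ j ∈ S, (∀ y ∈ F, l j y = 1) ∨ l j x < 1 := by
    intro S
    induction S using Finset.induction_on with
    | empty => exact ⟨hF.1.some, hF.1.some_mem, by simp⟩
    | insert k S _ ih =>
      obtain ⟨x, hx, hxS⟩ := ih
      by_cases hk : ∀ y ∈ F, l k y = 1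
      · refine ⟨x, hx, fun j hj => ?_⟩
        rcases Finset.mem_insert.1 hj with rfl | hj
        · exact Or.inl hk
        · exact hxS j hj
      · push Not at hk
        obtain ⟨y, hy, hyk⟩ := hk
        refine ⟨(1 / 2 : ℝ) • x + (1 / 2 : ℝ) • y, hF.convex h.convex hx hy (by norm_num)
          (by norm_num) (by norm_num), fun j hj => ?_⟩
        have hxj := h.le_one_of_mem j x (hF.subset hx)
        have hyj := h.le_one_of_mem j y (hF.subset hy)
        simp only [map_add, map_smul, smul_eq_mul]
        rcases Finset.mem_insert.1 hj with rfl | hj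
        · right
          have := lt_of_le_of_ne hyj hyk
          linarith
        · rcases hxS j hj with h1 | h1
          · exact Or.inl h1
          · right; linarith
  obtain ⟨x, hx, hxj⟩ := hint Finset.univ
  obtain ⟨k, c, hk, hFk⟩ := hF.exists_functional
  rintro y ⟨hy, hyJ⟩
  -- The segment from `y` to `x` can be prolonged slightly beyond `x` inside `P`; if `k y < c`, the
  -- functional `k` would exceed `c` there.
  have hev : ∀ᶠ ε : ℝ in nhdsWithin 0 (Set.Ioi 0), ∀ j, l j (x + ε • (x - y)) ≤ 1 := by
    rw [Filter.eventually_all]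
    intro j
    rcases hxj j (Finset.mem_univ j) with h1 | h1
    · refine Filter.Eventually.of_forall fun ε => ?_
      simp [h1 x hx, hyJ j h1]
    · have hc : Continuous fun ε : ℝ => l j (x + ε • (x - y)) := by
        simp only [map_add, map_smul, smul_eq_mul]
        fun_prop
      have := (hc.tendsto 0).eventually_lt_const (u := 1) (by simpa using h1)
      exact (this.filter_mono nhdsWithin_le_nhds).mono fun ε hε => hε.le
  obtain ⟨ε, hε, hε0⟩ := (hev.and self_mem_nhdsWithin).exists
  have hε0 : 0 < ε := hε0
  have hxs := Submodule.subset_span (R := ℝ) (hF.subset hx)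
  have hys := Submodule.subset_span (R := ℝ) hy
  have hmem : x + ε • (x - y) ∈ P := (h.mem_iff (add_mem hxs (Submodule.smul_mem _ _
    (sub_mem hxs hys)))).2 hε
  have h1 := hk _ hmem
  have h2 : k x = c := (hFk ▸ hx : x ∈ {x ∈ P | k x = c}).2
  simp only [map_add, map_smul, map_sub, smul_eq_mul, h2] at h1
  have h3 := hk y hy
  have h4 : ε * (c - k y) ≤ 0 := by linarith
  have h5 : c - k y ≤ 0 := nonpos_of_mul_nonpos_right h4 hε0
  rw [hFk]
  exact ⟨hy, by linarith⟩

theorem Realization.isFace_tight (h : Realization P R v l) (J : List κ)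
    (hne : {x ∈ P | ∀ j ∈ J, l j x = 1}.Nonempty) : IsFace P {x ∈ P | ∀ j ∈ J, l j x = 1} := by
  induction J with
  | nil => simpa using isFace_self ⟨0, h.zero_mem⟩
  | cons k J ih =>
    have heq : {x ∈ P | ∀ j ∈ k :: J, l j x = 1} =
        {x ∈ P | l k x = 1} ∩ {x ∈ P | ∀ j ∈ J, l j x = 1} := by
      ext x
      simp only [List.forall_mem_cons, Set.mem_inter_iff, Set.mem_ofPred_eq]
      tauto
    rw [heq] at hne ⊢
    refine IsFace.inter (isFace_of_functional _ _ (h.le_one_of_mem k) ?_) (ih ?_) hne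
    · exact hne.mono Set.inter_subset_left
    · exact hne.mono Set.inter_subset_right

theorem Realization.tight_eq_convexHull [Finite ι] (h : Realization P R v l) (J : List κ)
    (hne : {x ∈ P | ∀ j ∈ J, l j x = 1}.Nonempty) :
    {x ∈ P | ∀ j ∈ J, l j x = 1} = convexHull ℝ (v '' {i | ∀ j ∈ J, R i j = true}) := by
  have hF := h.isFace_tight J hne
  set F := {x ∈ P | ∀ j ∈ J, l j x = 1} with hFdef
  have hP : P = convexHull ℝ ((Set.finite_range v).toFinset : Set E) := by simpa using h.hull
  have hF' : IsFace (convexHull ℝ ((Set.finite_range v).toFinset : Set E)) F := hP ▸ hF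
  rw [hF'.eq_convexHull]
  congr 1
  ext x
  simp only [Set.Finite.mem_toFinset, Set.mem_range, Set.mem_ofPred_eq, Set.mem_image, hFdef]
  constructor
  · rintro ⟨⟨i, rfl⟩, -, hi⟩
    exact ⟨i, fun j hj => (h.tight i j).2 (hi j hj), rfl⟩
  · rintro ⟨i, hi, rfl⟩
    exact ⟨⟨i, rfl⟩, h.mem i, fun j hj => (h.tight i j).1 (hi j hj)⟩

end RealizationFaces

/-! ### Face lattices as lists of bit masks -/

/-- The mask of the vertices on the facet `k`. -/
def facetMask {κ : Type*} {n : ℕ} (R : Fin n → κ → Bool) (k : κ) : ℕ :=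
  Nat.ofBits fun i => R i k

/-- Intersection of vertex masks. -/
def interMask (full : ℕ) (Fs : List ℕ) : ℕ := Fs.foldr (fun f m => f &&& m) full

/-- All lists `lev 0, …, lev 4` together. -/
def allLevels (lev : ℕ → List ℕ) : List ℕ := (List.range 5).flatMap lev

/-- The nonempty intersections of the facet masks `Fs` are exactly the masks in
`lev 0, …, lev 4`, and each of them is part of a chain of length five through all levels. -/
def IsGrading (full : ℕ) (Fs : List ℕ) (lev : ℕ → List ℕ) : Prop :=
  full ∈ allLevels lev ∧
  (∀ m ∈ allLevels lev, m ≠ 0 ∧ (∀ f ∈ Fs, f &&& m = 0 ∨ f &&& m ∈ allLevels lev) ∧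
    interMask full (Fs.filter fun f => f &&& m = m) = m) ∧
  (∀ k ∈ List.range 4, (∀ m ∈ lev k, ∃ m' ∈ lev (k + 1), m &&& m' = m ∧ m ≠ m') ∧
    ∀ m' ∈ lev (k + 1), ∃ m ∈ lev k, m &&& m' = m ∧ m ≠ m') ∧
  ∀ k ∈ List.range 5, (lev k).Nodup

instance (full : ℕ) (Fs : List ℕ) (lev : ℕ → List ℕ) : Decidable (IsGrading full Fs lev) := by
  unfold IsGrading
  infer_instance

section Masks

variable {E κ : Type*} [NormedAddCommGroup E] [NormedSpace ℝ E] [FiniteDimensional ℝ E]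
  {P : Set E} {n : ℕ} {R : Fin n → κ → Bool} {v : Fin n → E} {l : κ → E →ₗ[ℝ] ℝ}

set_option linter.unusedSectionVars false

/-- The convex hull of the vertices in a mask. -/
def maskHull (v : Fin n → E) (m : ℕ) : Set E := convexHull ℝ (v '' {i | m.testBit i = true})

/-- The mask of the vertices that lie on all facets in `J`. -/
def tightMask (R : Fin n → κ → Bool) (J : List κ) : ℕ :=
  interMask (2 ^ n - 1) (J.map (facetMask R))

theorem tightMask_cons (R : Fin n → κ → Bool) (k : κ) (J : List κ) :
    tightMask R (k :: J) = facetMask R k &&& tightMask R J := rfl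

theorem testBit_facetMask (R : Fin n → κ → Bool) (k : κ) (i : Fin n) :
    (facetMask R k).testBit i = R i k := by
  rw [facetMask, Nat.testBit_ofBits_lt _ _ i.2]

theorem testBit_tightMask (R : Fin n → κ → Bool) (J : List κ) (i : Fin n) :
    (tightMask R J).testBit i = true ↔ ∀ j ∈ J, R i j = true := by
  induction J with
  | nil => simp [tightMask, interMask]
  | cons k J ih => simp [tightMask_cons, testBit_facetMask, ih]

theorem testBit_tightMask_of_ge (R : Fin n → κ → Bool) (J : List κ) {i : ℕ} (hi : n ≤ i) :
    (tightMask R J).testBit i = false := by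
  induction J with
  | nil => simp [tightMask, interMask, hi]
  | cons k J ih => simp [tightMask_cons, ih]

/-- A mask is closed if it is a nonempty intersection of facets. -/
def IsClosedMask (R : Fin n → κ → Bool) (m : ℕ) : Prop := m ≠ 0 ∧ ∃ J, tightMask R J = m

theorem IsClosedMask.exists_testBit {m : ℕ} (hm : IsClosedMask R m) :
    ∃ i : Fin n, m.testBit i = true := by
  obtain ⟨hm0, J, rfl⟩ := hm
  obtain ⟨i, hi⟩ := Nat.exists_testBit_of_ne_zero hm0
  rcases lt_or_ge i n with h | h
  · exact ⟨⟨i, h⟩, hi⟩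
  · rw [testBit_tightMask_of_ge R J h] at hi
    exact absurd hi (by simp)

theorem IsClosedMask.testBit_lt {m : ℕ} (hm : IsClosedMask R m) {i : ℕ} (hi : m.testBit i = true) :
    i < n := by
  obtain ⟨-, J, rfl⟩ := hm
  by_contra h
  rw [testBit_tightMask_of_ge R J (not_lt.1 h)] at hi
  exact absurd hi (by simp)

theorem Realization.maskHull_eq (h : Realization P R v l) {J : List κ}
    (hm : IsClosedMask R (tightMask R J)) :
    IsFace P {x ∈ P | ∀ j ∈ J, l j x = 1} ∧
      maskHull v (tightMask R J) = {x ∈ P | ∀ j ∈ J, l j x = 1} := by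
  obtain ⟨i, hi⟩ := hm.exists_testBit
  have hne : {x ∈ P | ∀ j ∈ J, l j x = 1}.Nonempty :=
    ⟨v i, h.mem i, fun j hj => (h.tight i j).1 ((testBit_tightMask R J i).1 hi j hj)⟩
  refine ⟨h.isFace_tight J hne, ?_⟩
  rw [h.tight_eq_convexHull J hne, maskHull]
  simp only [testBit_tightMask]

theorem Realization.isFace_maskHull (h : Realization P R v l) {m : ℕ} (hm : IsClosedMask R m) :
    IsFace P (maskHull v m) := by
  obtain ⟨-, J, rfl⟩ := id hm
  obtain ⟨h1, h2⟩ := h.maskHull_eq hm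
  rwa [h2]

theorem Realization.mem_maskHull (h : Realization P R v l) {m : ℕ} (hm : IsClosedMask R m)
    (i : Fin n) : v i ∈ maskHull v m ↔ m.testBit i = true := by
  obtain ⟨-, J, rfl⟩ := id hm
  rw [(h.maskHull_eq hm).2, testBit_tightMask]
  exact ⟨fun hi j hj => (h.tight i j).2 (hi.2 j hj),
    fun hi => ⟨h.mem i, fun j hj => (h.tight i j).1 (hi j hj)⟩⟩

/-- The hull of a closed mask contains no listed point outside the mask, so inclusion of faces can
be read off bit by bit. -/
theorem Realization.maskHull_subset_iff (h : Realization P R v l) {m m' : ℕ}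
    (hm : IsClosedMask R m) (hm' : IsClosedMask R m') :
    maskHull v m ⊆ maskHull v m' ↔ m &&& m' = m := by
  constructor
  · intro hs
    refine Nat.eq_of_testBit_eq fun i => ?_
    rw [Nat.testBit_and]
    rcases hi : m.testBit i with _ | _
    · rfl
    · have := (h.mem_maskHull hm' ⟨i, hm.testBit_lt hi⟩).1 (hs ((h.mem_maskHull hm _).2 hi))
      simpa using this
  · intro he
    refine convexHull_mono (Set.image_mono fun i hi => ?_)
    have hi : m.testBit i = true := hi
    rw [← he, Nat.testBit_and, Bool.and_eq_true] at hi
    exact hi.2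

theorem Realization.maskHull_inj (h : Realization P R v l) {m m' : ℕ}
    (hm : IsClosedMask R m) (hm' : IsClosedMask R m') (he : maskHull v m = maskHull v m') :
    m = m' := by
  have h1 := (h.maskHull_subset_iff hm hm').1 he.le
  have h2 := (h.maskHull_subset_iff hm' hm).1 he.ge
  rw [Nat.and_comm] at h2
  exact h1.symm.trans h2

/-- The mask is the intersection of all facets containing `F`, which cut out `F` by
`Realization.face_eq`. -/
theorem Realization.exists_mask (h : Realization P R v l) {ks : List κ} (hks : ∀ k, k ∈ ks)
    {F : Set E} (hF : IsFace P F) : ∃ m, IsClosedMask R m ∧ F = maskHull v m := by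
  classical
  have : Finite κ := Set.finite_univ_iff.1 (ks.finite_toSet.subset fun k _ => hks k)
  set J := ks.filter fun k => ∀ y ∈ F, l k y = 1 with hJ
  have hFJ : F = {x ∈ P | ∀ j ∈ J, l j x = 1} := by
    conv_lhs => rw [h.face_eq hF]
    simp [hJ, hks]
  have hconv := h.tight_eq_convexHull J (hFJ ▸ hF.1)
  have hne : tightMask R J ≠ 0 := by
    intro h0
    obtain ⟨x, hx⟩ := hF.1
    rw [hFJ, hconv] at hx
    have : {i | ∀ j ∈ J, R i j = true} = ∅ := by
      ext i
      rw [Set.mem_ofPred_eq, ← testBit_tightMask, h0]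
      simp
    rw [this] at hx
    simp at hx
  refine ⟨tightMask R J, ⟨hne, J, rfl⟩, ?_⟩
  rw [hFJ, (h.maskHull_eq ⟨hne, J, rfl⟩).2]

theorem mem_allLevels {lev : ℕ → List ℕ} {m : ℕ} :
    m ∈ allLevels lev ↔ ∃ k < 5, m ∈ lev k := by
  simp [allLevels]

theorem IsGrading.isClosedMask {lev : ℕ → List ℕ} {ks : List κ}
    (hg : IsGrading (2 ^ n - 1) (ks.map (facetMask R)) lev) {m : ℕ} (hm : m ∈ allLevels lev) :
    IsClosedMask R m := by
  obtain ⟨h0, -, h⟩ := hg.2.1 m hm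
  refine ⟨h0, ks.filter fun k => facetMask R k &&& m = m, ?_⟩
  conv_rhs => rw [← h, List.filter_map]
  rfl

/-- The listed masks together with `0` are stable under intersection with one more facet, so all
intersections are reached from the full mask. -/
theorem IsGrading.mem_allLevels_of_isClosedMask {lev : ℕ → List ℕ} {ks : List κ}
    (hks : ∀ k, k ∈ ks) (hg : IsGrading (2 ^ n - 1) (ks.map (facetMask R)) lev) {m : ℕ}
    (hm : IsClosedMask R m) : m ∈ allLevels lev := by
  obtain ⟨h0, J, rfl⟩ := hm
  suffices h : tightMask R J = 0 ∨ tightMask R J ∈ allLevels lev from h.resolve_left h0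
  clear h0
  induction J with
  | nil => exact Or.inr hg.1
  | cons k J ih =>
    rw [tightMask_cons]
    rcases ih with ih | ih
    · simp [ih]
    · exact (hg.2.1 _ ih).2.1 _ (List.mem_map_of_mem (hks k))

variable {lev : ℕ → List ℕ} {ks : List κ}

/-- The level of a face in a graded list of masks is its dimension. -/
theorem Realization.polyDim_maskHull (h : Realization P R v l) (hd : polyDim P = 4)
    (hg : IsGrading (2 ^ n - 1) (ks.map (facetMask R)) lev) {k m : ℕ} (hk : k < 5)
    (hm : m ∈ lev k) : polyDim (maskHull v m) = k := by
  have hcl : ∀ {k m : ℕ}, k < 5 → m ∈ lev k → IsClosedMask R m := fun hk hm =>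
    hg.isClosedMask (mem_allLevels.2 ⟨_, hk, hm⟩)
  have hlt : ∀ {k k' m m' : ℕ}, k < 5 → k' < 5 → m ∈ lev k → m' ∈ lev k' → m &&& m' = m →
      m ≠ m' → polyDim (maskHull v m) < polyDim (maskHull v m') := by
    intro k k' m m' hk hk' hm hm' hs hne
    have c := hcl hk hm
    have c' := hcl hk' hm'
    refine (h.isFace_maskHull c).polyDim_lt ?_ (h.isFace_maskHull c').subset
    exact ((h.maskHull_subset_iff c c').2 hs).ssubset_of_ne fun he => hne (h.maskHull_inj c c' he)
  -- Strict inclusion of faces raises the dimension: a chain down to level 0 bounds the dimension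
  -- from below, and a chain up to level 4, where it is at most 4, bounds it from above.
  have hge : ∀ k < 5, ∀ m ∈ lev k, k ≤ polyDim (maskHull v m) := by
    intro k
    induction k with
    | zero => intros; exact Nat.zero_le _
    | succ k ih =>
      intro hk m hm
      obtain ⟨m', hm', hs, hne⟩ := (hg.2.2.1 k (List.mem_range.2 (by omega))).2 m hm
      have h1 := ih (by omega) m' hm'
      have h2 := hlt (by omega) hk hm' hm hs hne
      omega
  have hle : ∀ j ≤ 4, ∀ m ∈ lev (4 - j), polyDim (maskHull v m) + j ≤ 4 := by
    intro j
    induction j with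
    | zero =>
      intro _ m hm
      rw [add_zero, ← hd]
      exact polyDim_mono (h.isFace_maskHull (hcl (by norm_num) hm)).subset
    | succ j ih =>
      intro hj m hm
      obtain ⟨m', hm', hs, hne⟩ := (hg.2.2.1 (4 - (j + 1)) (List.mem_range.2 (by omega))).1 m hm
      rw [show 4 - (j + 1) + 1 = 4 - j by omega] at hm'
      have h1 := ih (by omega) m' hm'
      have h2 := hlt (by omega) (by omega) hm hm' hs hne
      omega
  have h1 := hge k hk m hm
  have h2 := hle (4 - k) (by omega) m (by rwa [show 4 - (4 - k) = k by omega])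
  omega

theorem Realization.isFaceOfDim_iff_mask (h : Realization P R v l) (hd : polyDim P = 4)
    (hks : ∀ k, k ∈ ks) (hg : IsGrading (2 ^ n - 1) (ks.map (facetMask R)) lev) {k : ℕ}
    (hk : k < 5) {F : Set E} : IsFaceOfDim P k F ↔ ∃ m ∈ lev k, maskHull v m = F := by
  rw [isFaceOfDim_iff]
  constructor
  · rintro ⟨hF, hFd⟩
    obtain ⟨m, hm, rfl⟩ := h.exists_mask hks hF
    obtain ⟨k', hk', hm'⟩ := mem_allLevels.1 (hg.mem_allLevels_of_isClosedMask hks hm)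
    rw [h.polyDim_maskHull hd hg hk' hm'] at hFd
    exact ⟨m, hFd ▸ hm', rfl⟩
  · rintro ⟨m, hm, rfl⟩
    exact ⟨h.isFace_maskHull (hg.isClosedMask (mem_allLevels.2 ⟨k, hk, hm⟩)),
      h.polyDim_maskHull hd hg hk hm⟩

theorem Realization.flagNumber_singleton (h : Realization P R v l) (hd : polyDim P = 4)
    (hks : ∀ k, k ∈ ks) (hg : IsGrading (2 ^ n - 1) (ks.map (facetMask R)) lev) (i : Fin 4) :
    flagNumber {i} P = (lev i).length := by
  classical
  have hi : (i : ℕ) < 5 := by omega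
  rw [_root_.flagNumber_singleton]
  have heq : {F | IsFaceOfDim P i F} = maskHull v '' ((lev i).toFinset : Set ℕ) := by
    ext F
    simp [h.isFaceOfDim_iff_mask hd hks hg hi]
  rw [heq, Set.InjOn.ncard_image, Set.ncard_coe_finset,
    List.toFinset_card_of_nodup (hg.2.2.2 i (List.mem_range.2 hi))]
  intro m hm m' hm' he
  exact h.maskHull_inj (hg.isClosedMask (mem_allLevels.2 ⟨i, hi, by simpa using hm⟩))
    (hg.isClosedMask (mem_allLevels.2 ⟨i, hi, by simpa using hm'⟩)) he

theorem Realization.flagNumber_pair (h : Realization P R v l) (hd : polyDim P = 4)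
    (hks : ∀ k, k ∈ ks) (hg : IsGrading (2 ^ n - 1) (ks.map (facetMask R)) lev) {i j : Fin 4}
    (hij : i < j) :
    flagNumber {i, j} P =
      ((lev i ×ˢ lev j).filter fun p : ℕ × ℕ => p.1 &&& p.2 = p.1).length := by
  classical
  have hi : (i : ℕ) < 5 := by omega
  have hj : (j : ℕ) < 5 := by omega
  have hci : ∀ {m}, m ∈ lev i → IsClosedMask R m := fun hm =>
    hg.isClosedMask (mem_allLevels.2 ⟨i, hi, hm⟩)
  have hcj : ∀ {m}, m ∈ lev j → IsClosedMask R m := fun hm =>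
    hg.isClosedMask (mem_allLevels.2 ⟨j, hj, hm⟩)
  rw [_root_.flagNumber_pair hij]
  have heq : {p : Set E × Set E | IsFaceOfDim P i p.1 ∧ IsFaceOfDim P j p.2 ∧ p.1 ⊆ p.2} =
      Prod.map (maskHull v) (maskHull v) ''
        (((lev i ×ˢ lev j).filter fun p : ℕ × ℕ => p.1 &&& p.2 = p.1).toFinset : Set (ℕ × ℕ)) := by
    ext ⟨F, G⟩
    simp only [Set.mem_ofPred_eq, h.isFaceOfDim_iff_mask hd hks hg hi,
      h.isFaceOfDim_iff_mask hd hks hg hj, Set.mem_image, List.coe_toFinset, List.mem_filter,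
      List.mem_product, decide_eq_true_eq, Prod.exists, Prod.map_apply, Prod.mk.injEq]
    constructor
    · rintro ⟨⟨m, hm, rfl⟩, ⟨m', hm', rfl⟩, hs⟩
      exact ⟨m, m', ⟨⟨hm, hm'⟩, (h.maskHull_subset_iff (hci hm) (hcj hm')).1 hs⟩, rfl, rfl⟩
    · rintro ⟨m, m', ⟨⟨hm, hm'⟩, hs⟩, rfl, rfl⟩
      exact ⟨⟨m, hm, rfl⟩, ⟨m', hm', rfl⟩, (h.maskHull_subset_iff (hci hm) (hcj hm')).2 hs⟩
  rw [heq, Set.InjOn.ncard_image, Set.ncard_coe_finset, List.toFinset_card_of_nodup]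
  · exact (List.Nodup.product (hg.2.2.2 i (List.mem_range.2 hi))
      (hg.2.2.2 j (List.mem_range.2 hj))).filter _
  · rintro ⟨a, b⟩ hab ⟨a', b'⟩ hab' he
    simp only [List.coe_toFinset, List.mem_filter, List.mem_product, Set.mem_ofPred_eq] at hab hab'
    simp only [Prod.map_apply, Prod.mk.injEq] at he
    rw [h.maskHull_inj (hci hab.1.1) (hci hab'.1.1) he.1,
      h.maskHull_inj (hcj hab.1.2) (hcj hab'.1.2) he.2]

end Masks

/-! ### Computation of face lattices -/

/-- All intersections of the masks `Fs`. -/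
def closedMasks (full : ℕ) (Fs : List ℕ) : List ℕ :=
  -- This computation only proposes a list; `IsGrading` certifies the outcome.
  Fs.foldr (fun f L => L.foldr (fun m L' => List.insert (f &&& m) L') L) [full]

/-- Successive layers of minimal masks. -/
def peelMinimal : ℕ → List ℕ → List (List ℕ)
  | 0, _ => []
  | k + 1, L =>
    let mins := L.filter fun m => L.all fun m' => m' == m || m' &&& m != m'
    mins :: peelMinimal k (L.filter fun m => !mins.contains m)

/-- The layers of the lattice of nonempty intersections of the masks `Fs`. -/
def faceLevels (full : ℕ) (Fs : List ℕ) (k : ℕ) : List ℕ :=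
  -- The mask `0` of the empty face is dropped, so that layers 0 to 4 correspond to dimensions 0 to
  -- 4.
  (peelMinimal 5 ((closedMasks full Fs).filter (· != 0))).getD k []

/-- The facet masks of an incidence relation with listed vertices and facets. -/
def facetMasks {ι κ : Type*} (R : ι → κ → Bool) (vs : List ι) (ks : List κ) : List ℕ :=
  ks.map (facetMask fun i : Fin vs.length => R (vs.get i))

/-- Twice the value of `f_02 - (3/2) (f_1 + f_2)` on a graded list of masks. -/
def twiceAlpha (lev : ℕ → List ℕ) : ℤ :=
  2 * ((lev 0 ×ˢ lev 2).filter fun p : ℕ × ℕ => p.1 &&& p.2 = p.1).length -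
    3 * ((lev 1).length + (lev 2).length)

/-- `lev` is the list of face masks and `a` is twice the value of the functional on it. -/
def HasTwiceAlpha {ι κ : Type*} (R : ι → κ → Bool) (vs : List ι) (ks : List κ) (a : ℤ) : Prop :=
  IsGrading (2 ^ vs.length - 1) (facetMasks R vs ks)
      (faceLevels (2 ^ vs.length - 1) (facetMasks R vs ks)) ∧
    twiceAlpha (faceLevels (2 ^ vs.length - 1) (facetMasks R vs ks)) = a

instance {ι κ : Type*} (R : ι → κ → Bool) (vs : List ι) (ks : List κ) (a : ℤ) :
    Decidable (HasTwiceAlpha R vs ks a) := by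
  unfold HasTwiceAlpha
  infer_instance

theorem Realizes.flagEval_alphaFunctional {E ι κ : Type*} [NormedAddCommGroup E] [NormedSpace ℝ E]
    [FiniteDimensional ℝ E] {P : Set E} {R : ι → κ → Bool} (h : Realizes P R) (hd : polyDim P = 4)
    {vs : List ι} {ks : List κ} (hvs : ∀ i, i ∈ vs) (hks : ∀ k, k ∈ ks) {a : ℤ}
    (ha : HasTwiceAlpha R vs ks a) : flagEval alphaFunctional P = a / 2 := by
  obtain ⟨v, l, h⟩ := h.reindex (fun i : Fin vs.length => R (vs.get i)) vs.get id
    (fun i => List.mem_iff_get.1 (hvs i)) Function.surjective_id fun _ _ => rfl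
  obtain ⟨hg, ha⟩ := ha
  rw [_root_.flagEval_alphaFunctional, h.flagNumber_singleton hd hks hg,
    h.flagNumber_singleton hd hks hg, h.flagNumber_pair hd hks hg (by decide), ← ha, twiceAlpha]
  push_cast
  simp only [Fin.val_zero, Fin.val_one, Fin.val_two]
  ring

/-! ### Incidence relations of products, sums and Hanner polytopes -/

/-- The incidence relation of a product of polytopes. -/
def prodIncidence {ι κ ι' κ' : Type*} (R : ι → κ → Bool) (S : ι' → κ' → Bool) :
    ι × ι' → κ ⊕ κ' → Bool
  | p, Sum.inl j => R p.1 j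
  | p, Sum.inr j => S p.2 j

/-- The incidence relation of a direct sum of polytopes. -/
def sumIncidence {ι κ ι' κ' : Type*} (R : ι → κ → Bool) (S : ι' → κ' → Bool) :
    ι ⊕ ι' → κ × κ' → Bool
  | Sum.inl i, q => R i q.1
  | Sum.inr i, q => S i q.2

section Constructions

variable {E : Type*} [NormedAddCommGroup E] [NormedSpace ℝ E] [FiniteDimensional ℝ E]
  {A B : Set E}

set_option linter.unusedSectionVars false

/-- A projection adapted to two independent subspaces. -/
theorem exists_projection {U W : Submodule ℝ E} (h : Disjoint U W) :
    ∃ p : E →ₗ[ℝ] E, (∀ x ∈ U, p x = x) ∧ ∀ x ∈ W, p x = 0 := by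
  obtain ⟨W', hW, hc⟩ := h.exists_isCompl
  refine ⟨W'.projection W hc, fun x hx => ?_, fun x hx => ?_⟩
  · exact Submodule.projection_apply_left hc ⟨x, hW hx⟩
  · exact Submodule.projection_apply_right hc ⟨x, hx⟩

theorem Realizes.zero_mem {ι κ : Type*} {R : ι → κ → Bool} (h : Realizes A R) : (0 : E) ∈ A := by
  obtain ⟨v, l, h⟩ := h
  exact h.zero_mem

theorem span_add_eq_sup (hA : (0 : E) ∈ A) (hB : (0 : E) ∈ B) :
    Submodule.span ℝ (A + B) = Submodule.span ℝ A ⊔ Submodule.span ℝ B := by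
  apply le_antisymm
  · rw [Submodule.span_le]
    rintro _ ⟨a, ha, b, hb, rfl⟩
    exact add_mem (Submodule.mem_sup_left (Submodule.subset_span ha))
      (Submodule.mem_sup_right (Submodule.subset_span hb))
  · refine sup_le (Submodule.span_mono fun a ha => ?_) (Submodule.span_mono fun b hb => ?_)
    · exact ⟨a, ha, 0, hB, add_zero a⟩
    · exact ⟨0, hA, b, hb, zero_add b⟩

theorem span_convexHull_union :
    Submodule.span ℝ (convexHull ℝ (A ∪ B)) = Submodule.span ℝ A ⊔ Submodule.span ℝ B := by
  rw [← Submodule.span_union]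
  exact le_antisymm (Submodule.span_le.2 (convexHull_min Submodule.subset_span
    (Submodule.convex _))) (Submodule.span_mono (subset_convexHull ℝ _))

theorem polyDim_eq_finrank_span (hA : (0 : E) ∈ A) :
    polyDim A = Module.finrank ℝ (Submodule.span ℝ A) := by
  have h : vectorSpan ℝ A = Submodule.span ℝ A := by
    rw [vectorSpan_eq_span_vsub_set_right ℝ hA]
    simp
  rw [polyDim, h]

theorem finrank_sup_of_disjoint {U W : Submodule ℝ E} (h : Disjoint U W) :
    Module.finrank ℝ ↥(U ⊔ W) = Module.finrank ℝ U + Module.finrank ℝ W := by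
  rw [← Submodule.finrank_sup_add_finrank_inf_eq, h.eq_bot, finrank_bot, add_zero]

theorem polyDim_add_of_disjoint (hA : (0 : E) ∈ A) (hB : (0 : E) ∈ B)
    (h : Disjoint (Submodule.span ℝ A) (Submodule.span ℝ B)) :
    polyDim (A + B) = polyDim A + polyDim B := by
  have h0 : (0 : E) ∈ A + B := ⟨0, hA, 0, hB, add_zero 0⟩
  rw [polyDim_eq_finrank_span h0, polyDim_eq_finrank_span hA, polyDim_eq_finrank_span hB,
    span_add_eq_sup hA hB, finrank_sup_of_disjoint h]

theorem polyDim_convexHull_union_of_disjoint (hA : (0 : E) ∈ A) (hB : (0 : E) ∈ B)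
    (h : Disjoint (Submodule.span ℝ A) (Submodule.span ℝ B)) :
    polyDim (convexHull ℝ (A ∪ B)) = polyDim A + polyDim B := by
  have h0 : (0 : E) ∈ convexHull ℝ (A ∪ B) := subset_convexHull ℝ _ (Or.inl hA)
  rw [polyDim_eq_finrank_span h0, polyDim_eq_finrank_span hA, polyDim_eq_finrank_span hB,
    span_convexHull_union, finrank_sup_of_disjoint h]

variable {ι κ ι' κ' : Type*} {R : ι → κ → Bool} {S : ι' → κ' → Bool}

/-- Facets of a product are facets of one factor, pulled back along the projections `p` and `id -
p`; the gauge condition splits into components. -/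
theorem Realizes.prod (hA : Realizes A R) (hB : Realizes B S)
    (h : Disjoint (Submodule.span ℝ A) (Submodule.span ℝ B)) :
    Realizes (A + B) (prodIncidence R S) := by
  have hA0 := hA.zero_mem
  have hB0 := hB.zero_mem
  obtain ⟨v, l, hA⟩ := hA
  obtain ⟨w, m, hB⟩ := hB
  obtain ⟨p, hpA, hpB⟩ := exists_projection h
  have hv : ∀ i, p (v i) = v i := fun i => hpA _ (Submodule.subset_span (hA.mem i))
  have hw : ∀ i, p (w i) = 0 := fun i => hpB _ (Submodule.subset_span (hB.mem i))
  refine ⟨fun q => v q.1 + w q.2,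
    Sum.elim (fun j => l j ∘ₗ p) (fun j => m j ∘ₗ (LinearMap.id - p)), ?_, ?_, ?_, ?_, ?_⟩
  · conv_lhs => rw [hA.hull, hB.hull, ← convexHull_add]
    congr 1
    ext x
    simp [Set.mem_add]
  · rintro ⟨i, i'⟩ (j | j)
    · simpa [hv, hw] using hA.le_one i j
    · simpa [hv, hw] using hB.le_one i' j
  · rintro ⟨i, i'⟩ (j | j)
    · simpa [hv, hw, prodIncidence] using hA.tight i j
    · simpa [hv, hw, prodIncidence] using hB.tight i' j
  · intro x hx
    rw [span_add_eq_sup hA0 hB0] at hx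
    obtain ⟨a, ha, b, hb, rfl⟩ := Submodule.mem_sup.1 hx
    obtain ⟨j, hj⟩ := hA.exists_nonneg a ha
    exact ⟨Sum.inl j, by simpa [hpA a ha, hpB b hb] using hj⟩
  · intro x hx s hs hl
    rw [span_add_eq_sup hA0 hB0] at hx
    obtain ⟨a, ha, b, hb, rfl⟩ := Submodule.mem_sup.1 hx
    rw [smul_add]
    refine Set.add_mem_add (hA.gauge a ha s hs fun j => ?_) (hB.gauge b hb s hs fun j => ?_)
    · simpa [hpA a ha, hpB b hb] using hl (Sum.inl j)
    · simpa [hpA a ha, hpB b hb] using hl (Sum.inr j)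

/-- Facets of a direct sum are pairs of facets, because the gauge of the sum is the sum of the
gauges. -/
theorem Realizes.sum [Finite κ] [Finite κ'] (hA : Realizes A R) (hB : Realizes B S)
    (h : Disjoint (Submodule.span ℝ A) (Submodule.span ℝ B)) :
    Realizes (convexHull ℝ (A ∪ B)) (sumIncidence R S) := by
  have hA0 := hA.zero_mem
  have hB0 := hB.zero_mem
  obtain ⟨v, l, hA⟩ := hA
  obtain ⟨w, m, hB⟩ := hB
  obtain ⟨p, hpA, hpB⟩ := exists_projection h
  have hv : ∀ i, p (v i) = v i := fun i => hpA _ (Submodule.subset_span (hA.mem i))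
  have hw : ∀ i, p (w i) = 0 := fun i => hpB _ (Submodule.subset_span (hB.mem i))
  refine ⟨Sum.elim v w, fun q => l q.1 ∘ₗ p + m q.2 ∘ₗ (LinearMap.id - p), ?_, ?_, ?_, ?_, ?_⟩
  · rw [Set.Sum.elim_range]
    refine Set.Subset.antisymm (convexHull_min ?_ (convex_convexHull ℝ _)) (convexHull_mono ?_)
    · refine Set.union_subset ?_ ?_
      · rw [hA.hull]
        exact convexHull_mono Set.subset_union_left
      · rw [hB.hull]
        exact convexHull_mono Set.subset_union_right
    · refine Set.union_subset_union ?_ ?_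
      · rintro _ ⟨i, rfl⟩; exact hA.mem i
      · rintro _ ⟨i, rfl⟩; exact hB.mem i
  · rintro (i | i) ⟨j, k⟩
    · simpa [hv, hw] using hA.le_one i j
    · simpa [hv, hw] using hB.le_one i k
  · rintro (i | i) ⟨j, k⟩
    · simpa [hv, hw, sumIncidence] using hA.tight i j
    · simpa [hv, hw, sumIncidence] using hB.tight i k
  · intro x hx
    rw [span_convexHull_union] at hx
    obtain ⟨a, ha, b, hb, rfl⟩ := Submodule.mem_sup.1 hx
    obtain ⟨j, hj⟩ := hA.exists_nonneg a ha
    obtain ⟨k, hk⟩ := hB.exists_nonneg b hb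
    exact ⟨(j, k), by simpa [hpA a ha, hpB b hb] using add_nonneg hj hk⟩
  · intro x hx s hs hl
    rw [span_convexHull_union] at hx
    obtain ⟨a, ha, b, hb, rfl⟩ := Submodule.mem_sup.1 hx
    obtain ⟨j₀, hj₀⟩ := hA.exists_nonneg a ha
    obtain ⟨k₀, hk₀⟩ := hB.exists_nonneg b hb
    have : Nonempty κ := ⟨j₀⟩
    have : Nonempty κ' := ⟨k₀⟩
    -- The maximal values at `a` and `b` are their gauges, and the single inequality for the pair
    -- `(j, k)` bounds their total by `s`.
    obtain ⟨j, hj⟩ := Finite.exists_max fun j => l j a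
    obtain ⟨k, hk⟩ := Finite.exists_max fun k => m k b
    have hj0 := hj₀.trans (hj j₀)
    have hk0 := hk₀.trans (hk k₀)
    have hsum : l j a + m k b ≤ s := by simpa [hpA a ha, hpB b hb] using hl (j, k)
    obtain ⟨a', ha', haa⟩ := hA.gauge a ha _ hj0 hj
    obtain ⟨b', hb', hbb⟩ := hB.gauge b hb _ hk0 hk
    have hC := convex_convexHull ℝ (A ∪ B)
    -- Dilates of a convex set containing `0` increase with the factor.
    have hsub : (l j a + m k b) • convexHull ℝ (A ∪ B) ⊆ s • convexHull ℝ (A ∪ B) := by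
      have h1 := hC.add_smul (add_nonneg hj0 hk0) (sub_nonneg.2 hsum)
      rw [add_sub_cancel] at h1
      rw [h1]
      intro y hy
      refine ⟨y, hy, 0, ⟨0, subset_convexHull ℝ _ (Or.inl hA0), smul_zero _⟩, add_zero y⟩
    apply hsub
    rw [hC.add_smul hj0 hk0]
    exact ⟨a, ⟨a', subset_convexHull ℝ _ (Or.inl ha'), haa⟩, b,
      ⟨b', subset_convexHull ℝ _ (Or.inr hb'), hbb⟩, rfl⟩

/-! ### Incidence types of low-dimensional Hanner polytopes -/

/-- The incidence relation of a segment. -/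
def segmentIncidence : Bool → Bool → Bool := fun i j => i == j

/-- The incidence relation of a parallelogram. -/
def squareIncidence : Bool × Bool → Bool ⊕ Bool → Bool :=
  prodIncidence segmentIncidence segmentIncidence

/-- The set is the segment from `-u` to `u`, where `u` maximizes a functional not vanishing on its
line; this functional, scaled to be 1 at `u`, and its negative are the two facets. -/
theorem realizes_segmentIncidence (hd : IsPolytopeOfDim 1 A) (hs : IsCentrallySymmetric A) :
    Realizes A segmentIncidence := by
  obtain ⟨⟨z, hz⟩, ⟨s, hsf, hAs⟩, hdim⟩ := hd
  have hconv : Convex ℝ A := hAs ▸ convex_convexHull ℝ s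
  have hcomp : IsCompact A := hAs ▸ hsf.isCompact_convexHull ℝ
  have hneg : ∀ x ∈ A, -x ∈ A := fun x hx => by
    rw [hs]; simpa using hx
  have h0 : (0 : E) ∈ A := by
    have := hconv hz (hneg z hz) (a := 1 / 2) (b := 1 / 2) (by norm_num) (by norm_num)
      (by norm_num)
    simpa using this
  rw [polyDim_eq_finrank_span h0] at hdim
  obtain ⟨w, hw0, hw⟩ := finrank_eq_one_iff'.1 hdim
  have hwE : (w : E) ∉ (⊥ : Submodule ℝ E) := by simpa using hw0
  obtain ⟨m, hmw, -⟩ := Submodule.exists_le_ker_of_notMem hwE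
  have hline : ∀ x ∈ Submodule.span ℝ A, ∀ y ∈ Submodule.span ℝ A, m y • x = m x • y := by
    intro x hx y hy
    obtain ⟨a, ha⟩ := hw ⟨x, hx⟩
    obtain ⟨b, hb⟩ := hw ⟨y, hy⟩
    have ha : a • (w : E) = x := congrArg Subtype.val ha
    have hb : b • (w : E) = y := congrArg Subtype.val hb
    rw [← ha, ← hb]
    simp only [map_smul, smul_smul, smul_eq_mul]
    congr 1; ring
  obtain ⟨u, hu, hmax⟩ := hcomp.exists_isMaxOn ⟨z, hz⟩
    (LinearMap.continuous_of_finiteDimensional m).continuousOn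
  have hmax : ∀ x ∈ A, m x ≤ m u := hmax
  have hmu : 0 < m u := by
    refine lt_of_le_of_ne (by simpa using hmax 0 h0) fun h => hmw ?_
    have hker : Submodule.span ℝ A ≤ LinearMap.ker m := Submodule.span_le.2 fun x hx => by
      have h1 := hmax x hx
      have h2 := hmax _ (hneg x hx)
      rw [map_neg] at h2
      exact le_antisymm (by linarith) (by linarith)
    exact hker w.2
  set f : E →ₗ[ℝ] ℝ := (m u)⁻¹ • m with hf
  have hfu : f u = 1 := by simp [hf, hmu.ne']
  have hfx : ∀ x ∈ Submodule.span ℝ A, x = f x • u := by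
    intro x hx
    have := hline x hx u (Submodule.subset_span hu)
    rw [hf, LinearMap.smul_apply, smul_eq_mul, mul_smul, ← this, smul_smul,
      inv_mul_cancel₀ hmu.ne', one_smul]
  have hgauge : ∀ x ∈ Submodule.span ℝ A, ∀ s : ℝ, 0 ≤ s → f x ≤ s → -f x ≤ s →
      ∃ t : ℝ, -1 ≤ t ∧ t ≤ 1 ∧ x = s • t • u := by
    intro x hx s hs h1 h2
    rcases hs.eq_or_lt with rfl | hs
    · refine ⟨0, by norm_num, by norm_num, ?_⟩
      rw [hfx x hx, show f x = 0 by linarith]; simp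
    · refine ⟨f x / s, ?_, ?_, ?_⟩
      · rw [le_div_iff₀ hs]; linarith
      · rw [div_le_iff₀ hs]; linarith
      · rw [smul_smul, mul_div_cancel₀ _ hs.ne', ← hfx x hx]
  have hseg : ∀ t : ℝ, -1 ≤ t → t ≤ 1 → ∀ C : Set E, Convex ℝ C → u ∈ C → -u ∈ C → t • u ∈ C := by
    intro t h1 h2 C hC h3 h4
    have := hC h3 h4 (a := (1 + t) / 2) (b := (1 - t) / 2) (by linarith) (by linarith) (by ring)
    convert this using 1
    rw [smul_neg, ← sub_eq_add_neg, ← sub_smul]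
    congr 1; ring
  refine ⟨fun i => if i then u else -u, fun j => if j then f else -f, ?_, ?_, ?_, ?_, ?_⟩
  · refine Set.Subset.antisymm (fun x hx => ?_) (convexHull_min ?_ hconv)
    · have hle : ∀ y ∈ A, f y ≤ 1 := fun y hy => by
        rw [hf, LinearMap.smul_apply, smul_eq_mul, inv_mul_le_iff₀ hmu, mul_one]
        exact hmax y hy
      have h1 := hle _ (hneg x hx)
      rw [map_neg] at h1
      obtain ⟨t, ht1, ht2, hxt⟩ := hgauge x (Submodule.subset_span hx) 1 zero_le_one (hle x hx) h1
      rw [hxt, one_smul]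
      exact hseg t ht1 ht2 _ (convex_convexHull ℝ _)
        (subset_convexHull ℝ _ ⟨true, by simp⟩) (subset_convexHull ℝ _ ⟨false, by simp⟩)
    · rintro _ ⟨i, rfl⟩
      cases i
      · simpa using hneg u hu
      · simpa using hu
  · rintro (_ | _) (_ | _) <;> simp [hfu]
  · rintro (_ | _) (_ | _) <;> simp [hfu, segmentIncidence] <;> norm_num
  · intro x _
    rcases le_total 0 (f x) with h | h
    · exact ⟨true, by simpa using h⟩
    · exact ⟨false, by simpa using h⟩
  · intro x hx s hs hl
    obtain ⟨t, h1, h2, rfl⟩ := hgauge x hx s hs (by simpa using hl true) (by simpa using hl false)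
    exact ⟨t • u, hseg t h1 h2 A hconv hu (hneg u hu), rfl⟩

/-- A direct sum of two segments is a parallelogram. -/
theorem Realizes.square_of_sum (h : Realizes A (sumIncidence segmentIncidence segmentIncidence)) :
    Realizes A squareIncidence :=
  -- The two summands are the diagonals of the square: vertices with equal coordinates on one, with
  -- unequal coordinates on the other.
  h.reindex squareIncidence (fun p => if p.1 == p.2 then Sum.inl p.1 else Sum.inr p.1)
    (Sum.elim (fun a => (a, a)) fun b => (b, !b)) (by decide) (by decide) (by decide)

/-- The incidence relations of Hanner polytopes of dimension at most four. -/
def IsHannerType (A : Set E) : Prop :=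
  (polyDim A = 1 ∧ Realizes A segmentIncidence) ∨
  (polyDim A = 2 ∧ Realizes A squareIncidence) ∨
  (polyDim A = 3 ∧ (Realizes A (prodIncidence segmentIncidence squareIncidence) ∨
    Realizes A (sumIncidence segmentIncidence squareIncidence))) ∨
  (polyDim A = 4 ∧
    (Realizes A (prodIncidence segmentIncidence (prodIncidence segmentIncidence squareIncidence)) ∨
    Realizes A (prodIncidence segmentIncidence (sumIncidence segmentIncidence squareIncidence)) ∨
    Realizes A (sumIncidence segmentIncidence (prodIncidence segmentIncidence squareIncidence)) ∨
    Realizes A (sumIncidence segmentIncidence (sumIncidence segmentIncidence squareIncidence)) ∨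
    Realizes A (prodIncidence squareIncidence squareIncidence) ∨
    Realizes A (sumIncidence squareIncidence squareIncidence))) ∨
  -- This alternative closes the induction over all Hanner polytopes without listing higher types.
  5 ≤ polyDim A

theorem IsHannerType.pos (hA : IsHannerType A) : 1 ≤ polyDim A := by
  rcases hA with ⟨h, -⟩ | ⟨h, -⟩ | ⟨h, -⟩ | ⟨h, -⟩ | h <;> omega

/-- Direct products of Hanner types, the factor of smaller dimension first. -/
theorem IsHannerType.add (hA : IsHannerType A) (hB : IsHannerType B)
    (hd : polyDim (A + B) = polyDim A + polyDim B) (hle : polyDim A ≤ polyDim B)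
    (h : Disjoint (Submodule.span ℝ A) (Submodule.span ℝ B)) : IsHannerType (A + B) := by
  have hA1 := hA.pos
  have hB1 := hB.pos
  rcases hA with ⟨ha, hA⟩ | ⟨ha, hA⟩ | ⟨ha, hA⟩ | ⟨ha, hA⟩ | ha
  · rcases hB with ⟨hb, hB⟩ | ⟨hb, hB⟩ | ⟨hb, hB | hB⟩ | ⟨hb, hB⟩ | hb
    · exact Or.inr (Or.inl ⟨by omega, hA.prod hB h⟩)
    · exact Or.inr (Or.inr (Or.inl ⟨by omega, Or.inl (hA.prod hB h)⟩))
    · exact Or.inr (Or.inr (Or.inr (Or.inl ⟨by omega, Or.inl (hA.prod hB h)⟩)))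
    · exact Or.inr (Or.inr (Or.inr (Or.inl ⟨by omega, Or.inr (Or.inl (hA.prod hB h))⟩)))
    · exact Or.inr (Or.inr (Or.inr (Or.inr (by omega))))
    · exact Or.inr (Or.inr (Or.inr (Or.inr (by omega))))
  · rcases hB with ⟨hb, hB⟩ | ⟨hb, hB⟩ | ⟨hb, hB⟩ | ⟨hb, hB⟩ | hb
    · omega
    · exact Or.inr (Or.inr (Or.inr (Or.inl ⟨by omega,
        Or.inr (Or.inr (Or.inr (Or.inr (Or.inl (hA.prod hB h)))))⟩)))
    all_goals exact Or.inr (Or.inr (Or.inr (Or.inr (by omega))))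
  all_goals exact Or.inr (Or.inr (Or.inr (Or.inr (by omega))))

/-- Direct sums of Hanner types, the summand of smaller dimension first. -/
theorem IsHannerType.convexHull_union (hA : IsHannerType A) (hB : IsHannerType B)
    (hd : polyDim (convexHull ℝ (A ∪ B)) = polyDim A + polyDim B) (hle : polyDim A ≤ polyDim B)
    (h : Disjoint (Submodule.span ℝ A) (Submodule.span ℝ B)) :
    IsHannerType (convexHull ℝ (A ∪ B)) := by
  have hA1 := hA.pos
  have hB1 := hB.pos
  rcases hA with ⟨ha, hA⟩ | ⟨ha, hA⟩ | ⟨ha, hA⟩ | ⟨ha, hA⟩ | ha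
  · rcases hB with ⟨hb, hB⟩ | ⟨hb, hB⟩ | ⟨hb, hB | hB⟩ | ⟨hb, hB⟩ | hb
    · exact Or.inr (Or.inl ⟨by omega, (hA.sum hB h).square_of_sum⟩)
    · exact Or.inr (Or.inr (Or.inl ⟨by omega, Or.inr (hA.sum hB h)⟩))
    · exact Or.inr (Or.inr (Or.inr (Or.inl ⟨by omega,
        Or.inr (Or.inr (Or.inl (hA.sum hB h)))⟩)))
    · exact Or.inr (Or.inr (Or.inr (Or.inl ⟨by omega,
        Or.inr (Or.inr (Or.inr (Or.inl (hA.sum hB h))))⟩)))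
    · exact Or.inr (Or.inr (Or.inr (Or.inr (by omega))))
    · exact Or.inr (Or.inr (Or.inr (Or.inr (by omega))))
  · rcases hB with ⟨hb, hB⟩ | ⟨hb, hB⟩ | ⟨hb, hB⟩ | ⟨hb, hB⟩ | hb
    · omega
    · exact Or.inr (Or.inr (Or.inr (Or.inl ⟨by omega,
        Or.inr (Or.inr (Or.inr (Or.inr (Or.inr (hA.sum hB h)))))⟩)))
    all_goals exact Or.inr (Or.inr (Or.inr (Or.inr (by omega))))
  all_goals exact Or.inr (Or.inr (Or.inr (Or.inr (by omega))))

/-- The origin is carried along because dimensions add only when both parts contain it;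
commutativity lets the smaller dimension come first, which halves the list of types. -/
theorem IsHanner.isHannerType (hA : IsHanner A) : (0 : E) ∈ A ∧ IsHannerType A := by
  induction hA with
  | segment A hA hs =>
    have h := realizes_segmentIncidence hA hs
    exact ⟨h.zero_mem, Or.inl ⟨hA.2.2, h⟩⟩
  | directProduct A B _ _ h ihA ihB =>
    obtain ⟨hA0, hA⟩ := ihA
    obtain ⟨hB0, hB⟩ := ihB
    refine ⟨⟨0, hA0, 0, hB0, add_zero 0⟩, ?_⟩
    rcases le_total (polyDim A) (polyDim B) with hle | hle
    · exact hA.add hB (polyDim_add_of_disjoint hA0 hB0 h) hle h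
    · rw [add_comm]
      exact hB.add hA (polyDim_add_of_disjoint hB0 hA0 h.symm) hle h.symm
  | directSum A B _ _ h ihA ihB =>
    obtain ⟨hA0, hA⟩ := ihA
    obtain ⟨hB0, hB⟩ := ihB
    refine ⟨subset_convexHull ℝ _ (Or.inl hA0), ?_⟩
    rcases le_total (polyDim A) (polyDim B) with hle | hle
    · exact hA.convexHull_union hB (polyDim_convexHull_union_of_disjoint hA0 hB0 h) hle h
    · rw [Set.union_comm]
      exact hB.convexHull_union hA (polyDim_convexHull_union_of_disjoint hB0 hA0 h.symm) hle h.symm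

end Constructions

/-! ### The values on Hanner polytopes -/

/-- The two elements of `Bool`. -/
def boolList : List Bool := [false, true]

/-- The elements of a disjoint union. -/
def sumList {α β : Type*} (as : List α) (bs : List β) : List (α ⊕ β) :=
  as.map Sum.inl ++ bs.map Sum.inr

theorem mem_boolList (b : Bool) : b ∈ boolList := by cases b <;> decide

theorem mem_sumList {α β : Type*} {as : List α} {bs : List β} (ha : ∀ a, a ∈ as)
    (hb : ∀ b, b ∈ bs) (x : α ⊕ β) : x ∈ sumList as bs := by
  cases x <;> simp [sumList, ha, hb]

theorem mem_prodList {α β : Type*} {as : List α} {bs : List β} (ha : ∀ a, a ∈ as)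
    (hb : ∀ b, b ∈ bs) (x : α × β) : x ∈ as ×ˢ bs :=
  List.mem_product.2 ⟨ha _, hb _⟩

/-- The vertices of a square. -/
def squareVertices : List (Bool × Bool) := boolList ×ˢ boolList

/-- The edges of a square. -/
def squareEdges : List (Bool ⊕ Bool) := sumList boolList boolList

theorem mem_squareVertices (x : Bool × Bool) : x ∈ squareVertices :=
  mem_prodList mem_boolList mem_boolList x

theorem mem_squareEdges (x : Bool ⊕ Bool) : x ∈ squareEdges :=
  mem_sumList mem_boolList mem_boolList x

/-- The number is `ℓ₁ + ℓ₂`: each of the 24 squares of the 4-cube has one vertex too many, and every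
edge lies in three facets. -/
theorem hasTwiceAlpha_prism_cube :
    HasTwiceAlpha (prodIncidence segmentIncidence (prodIncidence segmentIncidence squareIncidence))
      (boolList ×ˢ boolList ×ˢ squareVertices) (sumList boolList (sumList boolList squareEdges))
      24 := by
  decide +kernel

/-- Here the 12 square side faces contribute to `ℓ₁`, and the 6 vertical edges, each in four facets,
to `ℓ₂`. The bipyramid over the cube is the dual case. -/
theorem hasTwiceAlpha_prism_octahedron :
    HasTwiceAlpha (prodIncidence segmentIncidence (sumIncidence segmentIncidence squareIncidence))
      (boolList ×ˢ sumList boolList squareVertices) (sumList boolList (boolList ×ˢ squareEdges))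
      18 := by
  decide +kernel

theorem hasTwiceAlpha_bipyramid_cube :
    HasTwiceAlpha (sumIncidence segmentIncidence (prodIncidence segmentIncidence squareIncidence))
      (sumList boolList (boolList ×ˢ squareVertices)) (boolList ×ˢ sumList boolList squareEdges)
      18 := by
  decide +kernel

theorem hasTwiceAlpha_bipyramid_octahedron :
    HasTwiceAlpha (sumIncidence segmentIncidence (sumIncidence segmentIncidence squareIncidence))
      (sumList boolList (sumList boolList squareVertices)) (boolList ×ˢ boolList ×ˢ squareEdges)
      24 := by
  decide +kernel

theorem hasTwiceAlpha_square_prod_square :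
    HasTwiceAlpha (prodIncidence squareIncidence squareIncidence)
      (squareVertices ×ˢ squareVertices) (sumList squareEdges squareEdges) 24 := by
  decide +kernel

theorem hasTwiceAlpha_square_sum_square :
    HasTwiceAlpha (sumIncidence squareIncidence squareIncidence)
      (sumList squareVertices squareVertices) (squareEdges ×ˢ squareEdges) 24 := by
  decide +kernel

theorem IsHanner.flagEval_alphaFunctional {E : Type*} [NormedAddCommGroup E] [NormedSpace ℝ E]
    [FiniteDimensional ℝ E] {H : Set E} (hH : IsHanner H) (hd : polyDim H = 4) :
    flagEval alphaFunctional H = 9 ∨ flagEval alphaFunctional H = 12 := by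
  have hb := mem_boolList
  have hv := mem_squareVertices
  have he := mem_squareEdges
  rcases hH.isHannerType.2 with ⟨h, -⟩ | ⟨h, -⟩ | ⟨h, -⟩ | ⟨-, h | h | h | h | h | h⟩ | h
  · omega
  · omega
  · omega
  · right
    rw [h.flagEval_alphaFunctional hd (mem_prodList hb (mem_prodList hb hv))
      (mem_sumList hb (mem_sumList hb he)) hasTwiceAlpha_prism_cube]
    norm_num
  · left
    rw [h.flagEval_alphaFunctional hd (mem_prodList hb (mem_sumList hb hv))
      (mem_sumList hb (mem_prodList hb he)) hasTwiceAlpha_prism_octahedron]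
    norm_num
  · left
    rw [h.flagEval_alphaFunctional hd (mem_sumList hb (mem_prodList hb hv))
      (mem_prodList hb (mem_sumList hb he)) hasTwiceAlpha_bipyramid_cube]
    norm_num
  · right
    rw [h.flagEval_alphaFunctional hd (mem_sumList hb (mem_sumList hb hv))
      (mem_prodList hb (mem_prodList hb he)) hasTwiceAlpha_bipyramid_octahedron]
    norm_num
  · right
    rw [h.flagEval_alphaFunctional hd (mem_prodList hv hv) (mem_sumList he he)
      hasTwiceAlpha_square_prod_square]
    norm_num
  · right
    rw [h.flagEval_alphaFunctional hd (mem_sumList hv hv) (mem_prodList he he)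
      hasTwiceAlpha_square_sum_square]
    norm_num
  · omega

/-! ### The polytope `P_4` -/

section PolytopeP4

/-- The sign attached to a Boolean. -/
def boolSign (b : Bool) : ℤ := if b then 1 else -1

/-- The vertices of `P_4`: the sign vectors other than `±(1, 1, 1, 1)`. -/
def vertexP4 (i : Fin 14) (k : Fin 4) : ℤ := boolSign ((i.1 + 1).testBit k)

/-- The incidences between the vertices `x` of `P_4` and its facets, which lie in the hyperplanes
`± x_k = 1` and `± ∑ x_k = 2`. -/
def incidenceP4 (i : Fin 14) : Fin 4 × Bool ⊕ Bool → Bool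
  | Sum.inl (k, b) => boolSign b * vertexP4 i k = 1
  | Sum.inr b => boolSign b * ∑ k, vertexP4 i k = 2

/-- The facet functionals of `P_4`. -/
noncomputable def facetP4 : Fin 4 × Bool ⊕ Bool → (Fin 4 → ℝ) →ₗ[ℝ] ℝ
  | Sum.inl (k, b) => (boolSign b : ℝ) • LinearMap.proj k
  | Sum.inr b => ((boolSign b : ℝ) / 2) • ∑ k, LinearMap.proj k

theorem facetP4_inl (k : Fin 4) (b : Bool) (x : Fin 4 → ℝ) :
    facetP4 (Sum.inl (k, b)) x = boolSign b * x k := by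
  simp [facetP4]

theorem facetP4_inr (b : Bool) (x : Fin 4 → ℝ) :
    facetP4 (Sum.inr b) x = boolSign b * (∑ k, x k) / 2 := by
  simp only [facetP4, LinearMap.smul_apply, LinearMap.sum_apply, LinearMap.proj_apply, smul_eq_mul]
  ring

theorem mem_polytopeP4 {x : Fin 4 → ℝ} :
    x ∈ polytopeP4 ↔ (∀ i, -1 ≤ x i ∧ x i ≤ 1) ∧ -2 ≤ ∑ i, x i ∧ ∑ i, x i ≤ 2 := Iff.rfl

theorem zero_mem_polytopeP4 : (0 : Fin 4 → ℝ) ∈ polytopeP4 := by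
  simp [mem_polytopeP4]

theorem convex_polytopeP4 : Convex ℝ polytopeP4 := by
  intro x hx y hy a b ha hb hab
  rw [mem_polytopeP4] at hx hy ⊢
  obtain rfl : b = 1 - a := by linarith
  refine ⟨fun i => ⟨?_, ?_⟩, ?_, ?_⟩
  · simp only [Pi.add_apply, Pi.smul_apply, smul_eq_mul]
    nlinarith [hx.1 i, hy.1 i]
  · simp only [Pi.add_apply, Pi.smul_apply, smul_eq_mul]
    nlinarith [hx.1 i, hy.1 i]
  · simp only [Pi.add_apply, Pi.smul_apply, smul_eq_mul, Finset.sum_add_distrib, ← Finset.mul_sum]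
    nlinarith [hx.2, hy.2]
  · simp only [Pi.add_apply, Pi.smul_apply, smul_eq_mul, Finset.sum_add_distrib, ← Finset.mul_sum]
    nlinarith [hx.2, hy.2]

theorem isCompact_polytopeP4 : IsCompact polytopeP4 := by
  have h1 : IsCompact (Set.univ.pi fun _ : Fin 4 => Set.Icc (-1 : ℝ) 1) :=
    isCompact_univ_pi fun _ => isCompact_Icc
  have h2 : IsClosed {x : Fin 4 → ℝ | ∑ i, x i ∈ Set.Icc (-2 : ℝ) 2} :=
    isClosed_Icc.preimage (by fun_prop)
  convert h1.inter_right h2 using 1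
  ext x
  simp only [polytopeP4, Set.mem_inter_iff, Set.mem_univ_pi, Set.mem_ofPred_eq]

theorem eq_zero_of_extreme {E : Type*} [AddCommGroup E] [Module ℝ E] {P : Set E} {x d : E}
    (hx : x ∈ P.extremePoints ℝ) (h1 : x + d ∈ P) (h2 : x - d ∈ P) : d = 0 := by
  rw [mem_extremePoints] at hx
  have := (hx.2 _ h1 _ h2 ⟨1 / 2, 1 / 2, by norm_num, by norm_num, by norm_num, by
    rw [← smul_add, add_add_sub_cancel, ← two_smul ℝ x, smul_smul]; norm_num⟩).1
  simpa using this

/-- Suppose `x k` lies strictly between -1 and 1. If the sum constraints are slack, `x` can move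
both ways along coordinate `k`. If some other coordinate `j` is free, it can move along the
difference of the two basis vectors, which keeps the sum. Otherwise the other three coordinates are
signs and the sum is `± 2`, so `x k` would be an odd integer. -/
theorem extremePoints_polytopeP4_coord {x : Fin 4 → ℝ} (hx : x ∈ polytopeP4.extremePoints ℝ)
    (k : Fin 4) : x k = 1 ∨ x k = -1 := by
  have hxP := mem_polytopeP4.1 hx.1
  by_contra! hk
  have hk1 := lt_of_le_of_ne (hxP.1 k).2 hk.1
  have hk2 := lt_of_le_of_ne (hxP.1 k).1 hk.2.symm
  by_cases hs : -2 < ∑ i, x i ∧ ∑ i, x i < 2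
  · obtain ⟨ε, hε, h1, h2, h3, h4⟩ : ∃ ε : ℝ, 0 < ε ∧ ε ≤ 1 - x k ∧ ε ≤ 1 + x k ∧
        ε ≤ 2 - ∑ i, x i ∧ ε ≤ 2 + ∑ i, x i := by
      refine ⟨min (min (1 - x k) (1 + x k)) (min (2 - ∑ i, x i) (2 + ∑ i, x i)), ?_, ?_, ?_, ?_, ?_⟩
      · refine lt_min (lt_min ?_ ?_) (lt_min ?_ ?_) <;> linarith
      · exact (min_le_left _ _).trans (min_le_left _ _)
      · exact (min_le_left _ _).trans (min_le_right _ _)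
      · exact (min_le_right _ _).trans (min_le_left _ _)
      · exact (min_le_right _ _).trans (min_le_right _ _)
    have hd : (Pi.single k ε : Fin 4 → ℝ) = 0 := by
      refine eq_zero_of_extreme hx ?_ ?_ <;> rw [mem_polytopeP4]
      · refine ⟨fun i => ?_, ?_⟩
        · have := hxP.1 i
          rcases eq_or_ne i k with rfl | hik
          · simp only [Pi.add_apply, Pi.single_eq_same]
            constructor <;> linarith
          · simpa [hik] using this
        · simp only [Pi.add_apply, Finset.sum_add_distrib, Finset.sum_pi_single', Finset.mem_univ,
            if_true]
          constructor <;> linarith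
      · refine ⟨fun i => ?_, ?_⟩
        · have := hxP.1 i
          rcases eq_or_ne i k with rfl | hik
          · simp only [Pi.sub_apply, Pi.single_eq_same]
            constructor <;> linarith
          · simpa [hik] using this
        · simp only [Pi.sub_apply, Finset.sum_sub_distrib, Finset.sum_pi_single', Finset.mem_univ,
            if_true]
          constructor <;> linarith
    have := congrFun hd k
    simp only [Pi.single_eq_same, Pi.zero_apply] at this
    linarith
  · by_cases hj : ∃ j, j ≠ k ∧ x j ≠ 1 ∧ x j ≠ -1
    · obtain ⟨j, hjk, hj1, hj2⟩ := hj
      have hj1 := lt_of_le_of_ne (hxP.1 j).2 hj1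
      have hj2 := lt_of_le_of_ne (hxP.1 j).1 hj2.symm
      obtain ⟨ε, hε, h1, h2, h3, h4⟩ : ∃ ε : ℝ, 0 < ε ∧ ε ≤ 1 - x k ∧ ε ≤ 1 + x k ∧
          ε ≤ 1 - x j ∧ ε ≤ 1 + x j := by
        refine ⟨min (min (1 - x k) (1 + x k)) (min (1 - x j) (1 + x j)), ?_, ?_, ?_, ?_, ?_⟩
        · refine lt_min (lt_min ?_ ?_) (lt_min ?_ ?_) <;> linarith
        · exact (min_le_left _ _).trans (min_le_left _ _)
        · exact (min_le_left _ _).trans (min_le_right _ _)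
        · exact (min_le_right _ _).trans (min_le_left _ _)
        · exact (min_le_right _ _).trans (min_le_right _ _)
      have hd : (Pi.single k ε - Pi.single j ε : Fin 4 → ℝ) = 0 := by
        refine eq_zero_of_extreme hx ?_ ?_ <;> rw [mem_polytopeP4]
        · refine ⟨fun i => ?_, ?_⟩
          · have := hxP.1 i
            rcases eq_or_ne i k with rfl | hik
            · simp only [Pi.add_apply, Pi.sub_apply, Pi.single_eq_same,
                Pi.single_eq_of_ne hjk.symm]
              constructor <;> linarith
            · rcases eq_or_ne i j with rfl | hij
              · simp only [Pi.add_apply, Pi.sub_apply, Pi.single_eq_same, Pi.single_eq_of_ne hjk]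
                constructor <;> linarith
              · simpa [hik, hij] using this
          · simpa [Finset.sum_add_distrib, Finset.sum_sub_distrib] using hxP.2
        · refine ⟨fun i => ?_, ?_⟩
          · have := hxP.1 i
            rcases eq_or_ne i k with rfl | hik
            · simp only [Pi.sub_apply, Pi.single_eq_same, Pi.single_eq_of_ne hjk.symm]
              constructor <;> linarith
            · rcases eq_or_ne i j with rfl | hij
              · simp only [Pi.sub_apply, Pi.single_eq_same, Pi.single_eq_of_ne hjk]
                constructor <;> linarith
              · simpa [hik, hij] using this
          · simpa [Finset.sum_sub_distrib] using hxP.2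
      have := congrFun hd k
      simp only [Pi.sub_apply, Pi.single_eq_same, Pi.single_eq_of_ne hjk.symm, Pi.zero_apply,
        sub_zero] at this
      linarith
    · have hj' : ∀ j, j ≠ k → x j = 1 ∨ x j = -1 := by
        intro j hjk
        by_contra! h
        exact hj ⟨j, hjk, h.1, h.2⟩
      have hs' : ∑ i, x i = 2 ∨ ∑ i, x i = -2 := by
        by_contra! h
        exact hs ⟨lt_of_le_of_ne hxP.2.1 h.2.symm, lt_of_le_of_ne hxP.2.2 h.1⟩
      have hpar : ∃ z : ℤ, ∑ i ∈ Finset.univ.erase k, x i = 2 * z + 1 := by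
        have : ∀ S : Finset (Fin 4), k ∉ S → ∃ z : ℤ, ∑ i ∈ S, x i = 2 * z + S.card := by
          intro S
          induction S using Finset.induction_on with
          | empty => intro _; exact ⟨0, by simp⟩
          | insert a S ha ih =>
            intro hkS
            rw [Finset.mem_insert, not_or] at hkS
            obtain ⟨z, hz⟩ := ih hkS.2
            rw [Finset.sum_insert ha, hz, Finset.card_insert_of_notMem ha]
            rcases hj' a (Ne.symm hkS.1) with h | h
            · exact ⟨z, by rw [h]; push_cast; ring⟩
            · exact ⟨z - 1, by rw [h]; push_cast; ring⟩
        obtain ⟨z, hz⟩ := this (Finset.univ.erase k) (Finset.notMem_erase k _)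
        refine ⟨z + 1, ?_⟩
        rw [hz, Finset.card_erase_of_mem (Finset.mem_univ k)]
        simp
        ring
      obtain ⟨z, hz⟩ := hpar
      have hsum := Finset.add_sum_erase Finset.univ x (Finset.mem_univ k)
      rw [hz] at hsum
      have hzk : ∃ y : ℤ, x k = 2 * y + 1 := by
        rcases hs' with h | h
        · exact ⟨-z, by push_cast; linarith⟩
        · exact ⟨-z - 2, by push_cast; linarith⟩
      obtain ⟨y, hy⟩ := hzk
      rw [hy] at hk1 hk2
      have h1 : 2 * y + 1 < 1 := by exact_mod_cast hk1
      have h2 : -1 < 2 * y + 1 := by exact_mod_cast hk2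
      omega

theorem exists_vertexP4 : ∀ b : Fin 4 → Bool, -2 ≤ ∑ k, boolSign (b k) → ∑ k, boolSign (b k) ≤ 2 →
    ∃ i, ∀ k, vertexP4 i k = boolSign (b k) := by
  decide

/-- By Krein–Milman the polytope is the closed convex hull of its extreme points, which are among
the listed sign vectors; the hull of finitely many points is already closed. -/
theorem polytopeP4_eq_convexHull :
    polytopeP4 = convexHull ℝ (Set.range fun (i : Fin 14) (k : Fin 4) => (vertexP4 i k : ℝ)) := by
  apply Set.Subset.antisymm
  · rw [← closure_convexHull_extremePoints isCompact_polytopeP4 convex_polytopeP4]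
    refine closure_minimal (convexHull_mono fun x hx => ?_)
      ((Set.finite_range _).isClosed_convexHull ℝ)
    have hc := extremePoints_polytopeP4_coord hx
    have hb : ∀ k, ∃ b : Bool, x k = boolSign b := by
      intro k
      rcases hc k with h | h
      · exact ⟨true, by simp [h, boolSign]⟩
      · exact ⟨false, by simp [h, boolSign]⟩
    choose b hb using hb
    obtain ⟨-, h1, h2⟩ := mem_polytopeP4.1 hx.1
    simp only [hb] at h1 h2
    obtain ⟨i, hi⟩ := exists_vertexP4 b (by exact_mod_cast h1) (by exact_mod_cast h2)
    exact ⟨i, funext fun k => by simp only [hb k, hi k]⟩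
  · refine convexHull_min ?_ convex_polytopeP4
    rintro _ ⟨i, rfl⟩
    have h : ∀ i, (∀ k, -1 ≤ vertexP4 i k ∧ vertexP4 i k ≤ 1) ∧ -2 ≤ ∑ k, vertexP4 i k ∧
        ∑ k, vertexP4 i k ≤ 2 := by decide
    rw [mem_polytopeP4]
    beta_reduce
    exact_mod_cast h i

theorem polytopeP4_realizes : Realizes polytopeP4 incidenceP4 := by
  refine ⟨_, facetP4, polytopeP4_eq_convexHull, ?_, ?_, fun x _ => ?_, fun x _ s hs hl => ?_⟩
  · rintro i (⟨k, b⟩ | b)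
    · rw [facetP4_inl]
      have h : ∀ i k b, boolSign b * vertexP4 i k ≤ 1 := by decide
      exact_mod_cast h i k b
    · rw [facetP4_inr, div_le_one two_pos]
      have h : ∀ i b, boolSign b * ∑ k, vertexP4 i k ≤ 2 := by decide
      exact_mod_cast h i b
  · rintro i (⟨k, b⟩ | b)
    · rw [facetP4_inl, incidenceP4, decide_eq_true_iff]
      norm_cast
    · rw [facetP4_inr, incidenceP4, decide_eq_true_iff, div_eq_one_iff_eq two_ne_zero]
      norm_cast
  · rcases le_total 0 (x 0) with h | h
    · exact ⟨Sum.inl (0, true), by rw [facetP4_inl]; simpa [boolSign] using h⟩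
    · exact ⟨Sum.inl (0, false), by rw [facetP4_inl]; simpa [boolSign] using h⟩
  · have h1 : ∀ k, x k ≤ s := fun k => by
      simpa [facetP4_inl, boolSign] using hl (Sum.inl (k, true))
    have h2 : ∀ k, -x k ≤ s := fun k => by
      simpa [facetP4_inl, boolSign] using hl (Sum.inl (k, false))
    have h3 : (∑ k, x k) / 2 ≤ s := by
      simpa [facetP4_inr, boolSign] using hl (Sum.inr true)
    have h4 : -(∑ k, x k) / 2 ≤ s := by
      have := hl (Sum.inr false)
      rw [facetP4_inr] at this
      simpa only [boolSign, Bool.false_eq_true, if_false, Int.cast_neg, Int.cast_one, neg_mul,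
        one_mul] using this
    rcases hs.eq_or_lt with rfl | hs
    · refine ⟨0, zero_mem_polytopeP4, funext fun k => ?_⟩
      have := h1 k
      have := h2 k
      simp only [Pi.smul_apply, Pi.zero_apply, smul_zero]
      linarith
    · rw [Set.mem_smul_set_iff_inv_smul_mem₀ hs.ne', mem_polytopeP4]
      simp only [Pi.smul_apply, smul_eq_mul, inv_mul_eq_div, ← Finset.sum_div]
      refine ⟨fun k => ⟨?_, ?_⟩, ?_, ?_⟩
      · rw [le_div_iff₀ hs]; linarith [h2 k]
      · rw [div_le_iff₀ hs]; linarith [h1 k]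
      · rw [le_div_iff₀ hs]; linarith
      · rw [div_le_iff₀ hs]; linarith

theorem polyDim_polytopeP4 : polyDim polytopeP4 = 4 := by
  rw [polyDim_eq_finrank_span zero_mem_polytopeP4]
  have h : Submodule.span ℝ polytopeP4 = ⊤ := by
    rw [eq_top_iff, ← (Pi.basisFun ℝ (Fin 4)).span_eq]
    refine Submodule.span_mono ?_
    rintro _ ⟨k, rfl⟩
    rw [Pi.basisFun_apply, mem_polytopeP4]
    refine ⟨fun i => ?_, ?_⟩
    · rcases eq_or_ne i k with rfl | h
      · simp
      · simp [h]
    · simp only [Finset.sum_pi_single', Finset.mem_univ, if_true]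
      norm_num
  rw [h, finrank_top, Module.finrank_fin_fun]

theorem isPolytopeOfDim_polytopeP4 : IsPolytopeOfDim 4 polytopeP4 :=
  ⟨⟨0, zero_mem_polytopeP4⟩, ⟨_, Set.finite_range _, polytopeP4_eq_convexHull⟩,
    polyDim_polytopeP4⟩

theorem isCentrallySymmetric_polytopeP4 : IsCentrallySymmetric polytopeP4 := by
  ext x
  rw [Set.mem_neg, mem_polytopeP4, mem_polytopeP4]
  simp only [Pi.neg_apply, Finset.sum_neg_distrib, neg_le_neg_iff]
  constructor
  · rintro ⟨h1, h2, h3⟩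
    exact ⟨fun i => ⟨(h1 i).2, by linarith [(h1 i).1]⟩, h3, by linarith⟩
  · rintro ⟨h1, h2, h3⟩
    exact ⟨fun i => ⟨by linarith [(h1 i).2], (h1 i).1⟩, by linarith, h2⟩

/-- The twelve squares of the cube that avoid both removed vertices give `ℓ₁ = 12`; all other
2-faces are triangles, and `ℓ₂ = 0`. -/
theorem hasTwiceAlpha_polytopeP4 :
    HasTwiceAlpha incidenceP4 (List.finRange 14) (sumList (List.finRange 4 ×ˢ boolList) boolList)
      12 := by
  decide +kernel

theorem flagEval_alphaFunctional_polytopeP4 : flagEval alphaFunctional polytopeP4 = 6 := by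
  rw [polytopeP4_realizes.flagEval_alphaFunctional polyDim_polytopeP4 List.mem_finRange
    (mem_sumList (mem_prodList List.mem_finRange mem_boolList) mem_boolList)
    hasTwiceAlpha_polytopeP4]
  norm_num

end PolytopeP4

/-! ### Refutation of the conjecture in dimension four -/

theorem alphaFunctional_mem_flagCone : alphaFunctional ∈ flagCone 4 := by
  intro n P hP
  rw [flagEval_alphaFunctional_eq_ell hP.isPolytope hP.2.2]
  have h1 := ellOne_nonneg hP.isPolytope
  have h2 := ellTwo_nonneg hP.isPolytope hP.2.2
  linarith

/-- The polytope `P_4` refutes the conjecture in dimension four. -/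
theorem not_kalaiConjectureC_four : ¬ KalaiConjectureC 4 := by
  intro hC
  obtain ⟨m, H, hH, hd, hα⟩ :=
    hC 4 polytopeP4 isPolytopeOfDim_polytopeP4 isCentrallySymmetric_polytopeP4
  have h := hα _ alphaFunctional_mem_flagCone
  rw [flagEval_alphaFunctional_polytopeP4] at h
  rcases hH.flagEval_alphaFunctional hd with h' | h' <;> linarith

theorem theorem2 :
    -- Conjecture C fails in dimension 4
    ¬ KalaiConjectureC 4 ∧
    -- the functional is non-negative on the flag vectors of all 4-polytopes
    alphaFunctional ∈ flagCone 4 ∧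
    -- its two expressions agree on every 4-polytope
    (∀ (n : ℕ) (P : Set (Fin n → ℝ)), IsPolytopeOfDim 4 P →
      flagEval alphaFunctional P =
        (flagNumber ({0, 2} : Finset (Fin 4)) P : ℝ) -
          3 / 2 * ((flagNumber ({1} : Finset (Fin 4)) P : ℝ) +
            (flagNumber ({2} : Finset (Fin 4)) P : ℝ)) ∧
      flagEval alphaFunctional P = (ellOne P + ellTwo P) / 2) ∧
    -- the centrally symmetric 4-polytope P_4 has value 6
    IsPolytopeOfDim 4 polytopeP4 ∧ IsCentrallySymmetric polytopeP4 ∧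
    flagEval alphaFunctional polytopeP4 = 6 ∧
    -- every 4-dimensional Hanner polytope has value 9 or 12
    (∀ (m : ℕ) (H : Set (Fin m → ℝ)), IsHanner H → polyDim H = 4 →
      flagEval alphaFunctional H = 9 ∨ flagEval alphaFunctional H = 12) := by
  exact ⟨not_kalaiConjectureC_four, alphaFunctional_mem_flagCone,
    fun n P hP => ⟨flagEval_alphaFunctional P,
      flagEval_alphaFunctional_eq_ell hP.isPolytope hP.2.2⟩,
    isPolytopeOfDim_polytopeP4, isCentrallySymmetric_polytopeP4,
    flagEval_alphaFunctional_polytopeP4, fun m H hH hd => hH.flagEval_alphaFunctional hd⟩
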